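/- Let $\Delta=\{z\in\mathbb C:|z|<1\}$, let $\beta\ge 1$ be real and put $v(z)=1-|z|^\beta$ for $z\in\Delta$. Let $\mathcal H_{v_o}(\Delta)$ be the complex vector space of all holomorphic functions $f\colon\Delta\to\mathbb C$ such that $v(z)|f(z)|\to 0$ as $z$ tends to the boundary of $\Delta$ (that is, for every $\varepsilon>0$ there is a compact set $K\subset\Delta$ with $v(z)|f(z)|<\varepsilon$ for all $z\in\Delta\setminus K$), with the norm $\|f\|_v=\sup_{z\in\Delta}v(z)|f(z)|$. Let $T\colon\mathcal H_{v_o}(\Delta)\to\mathcal H_{v_o}(\Delta)$ be a complex-linear isometry, not assumed to be surjective. (a) If $\beta=2$, then there exist an automorphism (biholomorphic self-map) $\varphi$ of $\Delta$ and a complex number $\alpha$ with $|\alpha|=1$ such that $T(f)(z)=\alpha\,\varphi'(z)\,f(\varphi(z))$ for all $f\in\mathcal H_{v_o}(\Delta)$ and all $z\in\Delta$. (b) If $\beta\ne 2$, then there exist $\theta\in\mathbb R$ and a complex number $\alpha$ with $|\alpha|=1$ such that $T(f)(z)=\alpha f(ze^{i\theta})$ for all $f\in\mathcal H_{v_o}(\Delta)$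 and all $z\in\Delta$. In both cases $T$ is surjective. -/

import Mathlib

open Set Metric

noncomputable section

/-- A weight on a set `U ⊆ ℂ`: a continuous, bounded, strictly positive real-valued function
on `U` (only the values on `U` matter). -/
structure Weight (U : Set ℂ) where
  toFun : ℂ → ℝ
  continuousOn' : ContinuousOn toFun U
  bounded' : ∃ C : ℝ, ∀ z ∈ U, toFun z ≤ C
  pos' : ∀ z ∈ U, 0 < toFun z

instance (U : Set ℂ) : CoeFun (Weight U) (fun _ => ℂ → ℝ) := ⟨Weight.toFun⟩

/-- The holomorphic functions `f` on `U` with `v |f|` bounded on `U`, as a space of functions.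
A function on `U` is represented by its extension by `0` to `ℂ`, so that two elements are equal
exactly when they agree on `U`. -/
def weightedHolSubmodule {U : Set ℂ} (v : Weight U) : Submodule ℂ (ℂ → ℂ) where
  carrier := {f | DifferentiableOn ℂ f U ∧ (∀ z ∉ U, f z = 0) ∧
    ∃ C : ℝ, ∀ z ∈ U, v z * ‖f z‖ ≤ C}
  zero_mem' := ⟨differentiableOn_const 0, fun _ _ => rfl, 0, fun z _ => by simp⟩
  add_mem' := by
    rintro f g ⟨hf, hf0, C, hC⟩ ⟨hg, hg0, D, hD⟩
    refine ⟨hf.add hg, fun z hz => by simp [hf0 z hz, hg0 z hz], C + D, fun z hz => ?_⟩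
    calc v z * ‖f z + g z‖ ≤ v z * (‖f z‖ + ‖g z‖) :=
          mul_le_mul_of_nonneg_left (norm_add_le _ _) (v.pos' z hz).le
      _ ≤ C + D := by rw [mul_add]; exact add_le_add (hC z hz) (hD z hz)
  smul_mem' := by
    rintro c f ⟨hf, hf0, C, hC⟩
    refine ⟨hf.const_smul c, fun z hz => by simp [hf0 z hz], ‖c‖ * C, fun z hz => ?_⟩
    calc v z * ‖c • f z‖ = ‖c‖ * (v z * ‖f z‖) := by rw [norm_smul]; ring
      _ ≤ ‖c‖ * C := mul_le_mul_of_nonneg_left (hC z hz) (norm_nonneg c)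

/-- The space `H_v(U)`, which carries the weighted supremum norm defined below (a type of its own,
so that it does not inherit the topology of pointwise convergence). -/
def Hv {U : Set ℂ} (v : Weight U) : Type := ↥(weightedHolSubmodule v)

namespace Hv

variable {U : Set ℂ} {v : Weight U}

instance : AddCommGroup (Hv v) := inferInstanceAs (AddCommGroup ↥(weightedHolSubmodule v))
instance : Module ℂ (Hv v) := inferInstanceAs (Module ℂ ↥(weightedHolSubmodule v))
instance : CoeFun (Hv v) (fun _ => ℂ → ℂ) := ⟨fun f => f.1⟩

theorem add_apply (f g : Hv v) (z : ℂ) : (f + g) z = f z + g z := rfl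
theorem smul_apply (c : ℂ) (f : Hv v) (z : ℂ) : (c • f) z = c * f z := rfl
theorem zero_apply (z : ℂ) : (0 : Hv v) z = 0 := rfl

/-- The norm `‖f‖_v = sup_{z ∈ U} v(z) |f(z)|`. -/
instance : Norm (Hv v) := ⟨fun f => ⨆ z : U, v z * ‖f z‖⟩

theorem norm_def (f : Hv v) : ‖f‖ = ⨆ z : U, v z * ‖f z‖ := rfl

theorem bddAbove (f : Hv v) : BddAbove (range fun z : U => v z * ‖f z‖) := by
  obtain ⟨C, hC⟩ := f.2.2.2
  exact ⟨C, by rintro _ ⟨z, rfl⟩; exact hC z z.2⟩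

theorem le_norm (f : Hv v) {z : ℂ} (hz : z ∈ U) : v z * ‖f z‖ ≤ ‖f‖ :=
  le_ciSup f.bddAbove (⟨z, hz⟩ : U)

theorem norm_nonneg' (f : Hv v) : 0 ≤ ‖f‖ :=
  Real.iSup_nonneg fun z => mul_nonneg (v.pos' z z.2).le (norm_nonneg _)

theorem core : NormedSpace.Core ℂ (Hv v) where
  norm_nonneg := norm_nonneg'
  norm_smul c f := by
    rw [norm_def, norm_def, Real.mul_iSup_of_nonneg (norm_nonneg c)]
    congr 1
    funext z
    rw [smul_apply, norm_mul]
    ring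
  norm_triangle f g := by
    refine Real.iSup_le (fun z => ?_) (add_nonneg (norm_nonneg' f) (norm_nonneg' g))
    calc v z * ‖(f + g) z‖ ≤ v z * (‖f z‖ + ‖g z‖) :=
          mul_le_mul_of_nonneg_left (norm_add_le _ _) (v.pos' z z.2).le
      _ ≤ ‖f‖ + ‖g‖ := by rw [mul_add]; exact add_le_add (le_norm f z.2) (le_norm g z.2)
  norm_eq_zero_iff f := by
    constructor
    · intro h
      refine Subtype.ext (funext fun z => ?_)
      by_cases hz : z ∈ U
      · have h1 := le_norm f hz
        rw [h] at h1
        have h2 := v.pos' z hz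
        have h3 : ‖f z‖ ≤ 0 := by
          by_contra hc
          exact absurd h1 (not_le.mpr (mul_pos h2 (not_le.mp hc)))
        exact norm_le_zero_iff.mp h3
      · exact f.2.2.1 z hz
    · rintro rfl
      simp [norm_def, zero_apply]

instance : NormedAddCommGroup (Hv v) := NormedAddCommGroup.ofCore core
instance : NormedSpace ℂ (Hv v) := NormedSpace.ofCore core

end Hv

/-- The subspace `H_{v_o}(U)` of all `f` in `H_v(U)` such that `v(z)|f(z)|` tends to `0` as `z`
tends to the boundary of `U`; it carries the norm of `H_v(U)`. -/
def Hv0 {U : Set ℂ} (v : Weight U) : Submodule ℂ (Hv v) where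
  carrier := {f | ∀ ε > 0, ∃ K ⊆ U, IsCompact K ∧ ∀ z ∈ U \ K, v z * ‖f z‖ < ε}
  zero_mem' := fun ε hε => ⟨∅, empty_subset U, isCompact_empty, fun z _ => by
    simpa [Hv.zero_apply] using hε⟩
  add_mem' := by
    intro f g hf hg ε hε
    obtain ⟨K, hKU, hK, hK'⟩ := hf (ε / 2) (half_pos hε)
    obtain ⟨L, hLU, hL, hL'⟩ := hg (ε / 2) (half_pos hε)
    refine ⟨K ∪ L, union_subset hKU hLU, hK.union hL, fun z hz => ?_⟩
    have h1 := hK' z ⟨hz.1, fun h => hz.2 (Or.inl h)⟩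
    have h2 := hL' z ⟨hz.1, fun h => hz.2 (Or.inr h)⟩
    calc v z * ‖(f + g) z‖ ≤ v z * (‖f z‖ + ‖g z‖) :=
          mul_le_mul_of_nonneg_left (norm_add_le _ _) (v.pos' z hz.1).le
      _ < ε := by rw [mul_add]; linarith
  smul_mem' := by
    intro c f hf ε hε
    have hc : 0 < ‖c‖ + 1 := by positivity
    obtain ⟨K, hKU, hK, hK'⟩ := hf (ε / (‖c‖ + 1)) (div_pos hε hc)
    refine ⟨K, hKU, hK, fun z hz => ?_⟩
    have h1 := hK' z hz
    rw [lt_div_iff₀ hc] at h1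
    have h2 : 0 ≤ v z * ‖f z‖ := mul_nonneg (v.pos' z hz.1).le (norm_nonneg _)
    calc v z * ‖(c • f) z‖ = v z * ‖f z‖ * ‖c‖ := by rw [Hv.smul_apply, norm_mul]; ring
      _ ≤ v z * ‖f z‖ * (‖c‖ + 1) := mul_le_mul_of_nonneg_left (by linarith) h2
      _ < ε := h1

instance {U : Set ℂ} (v : Weight U) : CoeFun (Hv0 v) (fun _ => ℂ → ℂ) := ⟨fun f => f.1⟩

/-- The weight `v(z) = 1 - |z|^β` on the open unit disc, for `β ≥ 1`. -/
def powWeight (β : ℝ) (hβ : 1 ≤ β) : Weight (ball (0 : ℂ) 1) where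
  toFun z := 1 - ‖z‖ ^ β
  continuousOn' := (continuous_const.sub
    (continuous_norm.rpow_const fun _ => Or.inr (by linarith))).continuousOn
  bounded' := ⟨1, fun z _ => by
    have := Real.rpow_nonneg (norm_nonneg z) β
    linarith⟩
  pos' z hz := by
    have := Real.rpow_lt_one (norm_nonneg z) (mem_ball_zero_iff.mp hz)
      (show 0 < β by linarith)
    linarith

/-- `φ` restricts to an automorphism of the open unit disc: it is holomorphic there, maps the disc
into itself and has a holomorphic inverse on the disc. -/
def IsDiscAutomorphism (φ : ℂ → ℂ) : Prop :=
  DifferentiableOn ℂ φ (ball 0 1) ∧ MapsTo φ (ball 0 1) (ball 0 1) ∧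
    ∃ ψ : ℂ → ℂ, DifferentiableOn ℂ ψ (ball 0 1) ∧ MapsTo ψ (ball 0 1) (ball 0 1) ∧
      InvOn ψ φ (ball 0 1) (ball 0 1)

end

/-!
The proof dualizes `T` at peak points and then reads off the shape of `T` from an identity between
squared moduli of holomorphic functions.

Since `β ≥ 1`, the function `-log v` is convex on the disc viewed as a subset of the plane, so every
point `a` is a peak point: `exp (c z)` for a suitable `c` makes `v |f|` maximal at `a` only
(`exists_peak`). The norm is smooth at such a function (`Hv0.support_unique`) and attained by its
image under `T`, so for every `z` there are `w` and `l` with `T f w = l * f z` for all `f` and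
`v w * |l| = v z` (`exists_preimage_point`). This replaces an argument with extreme points of the
dual ball.

Let `g = T 1`, `h = T id` and `φ = h / g`. The set `F` of points `w` where `v |g| = v ∘ φ` and
`T f w = g w * f (φ w)` for all `f` is relatively closed where `g ≠ 0`, and `φ` maps it onto the
disc. By Sard's lemma and Baire's theorem (`exists_ball_subset_of_subset_image`) it contains an open
set on which `φ` is not critical.

On this open set put `κ = β / 2`, `A = φ ^ κ`, `B = w ^ κ` and let `G` be a square root of `g`, up to
a unimodular factor. The relation `v |g| = v ∘ φ` becomes `|A|² + |G|² = 1 + |B G|²`. Differentiating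
such an identity shows that `(A, G)` is a constant unitary image of `(B G, 1)`
(`exists_unitary_of_norm_sq_eq`), whence `A = η (B - s) / (1 - s̄ B)` and
`G = c / (1 - s̄ B)` (`exists_moebius_of_norm_sq_eq`).

If `s ≠ 0`, the function `g`, being holomorphic across the negative real axis, forces `w ^ κ` not to
jump there, so `κ` is an integer `k` (`exists_int_of_mul_sq_eq`); and `k ≥ 2` is impossible since
`φ ^ k` would have a simple zero (`pow_quotient_ne_moebius_pow`). Hence `s = 0` or `β = 2`, in both
cases `φ` is a disc automorphism, and the formula for `T f` extends to the disc by the identity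
theorem (`exists_eq_discMoebius_composition`). Such operators are invertible
(`exists_weighted_composition_eq`).
-/

/-! ### Norm-attaining functions and support functionals -/

section Support

variable {U : Set ℂ} {v : Weight U}

theorem Hv.continuousOn_weight_mul_norm (f : Hv v) : ContinuousOn (fun z => v z * ‖f z‖) U :=
  v.continuousOn'.mul f.2.1.continuousOn.norm

theorem Hv0.exists_norm_eq (f : Hv0 v) (hf : 0 < ‖f‖) : ∃ w ∈ U, v w * ‖f w‖ = ‖f‖ := by
  obtain ⟨K, hKU, hK, hKf⟩ := f.2 (‖f‖ / 2) (half_pos hf)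
  have hne : K.Nonempty := by
    rw [nonempty_iff_ne_empty]
    rintro rfl
    have : ‖f‖ ≤ ‖f‖ / 2 := Real.iSup_le (fun z => (hKf z ⟨z.2, by simp⟩).le) (by positivity)
    linarith
  obtain ⟨w, hwK, hw⟩ := hK.exists_isMaxOn hne (f.1.continuousOn_weight_mul_norm.mono hKU)
  refine ⟨w, hKU hwK, le_antisymm (f.1.le_norm (hKU hwK)) ?_⟩
  have h : ‖f‖ ≤ max (v w * ‖f w‖) (‖f‖ / 2) := by
    refine Real.iSup_le (fun z => ?_) (le_max_of_le_right (by positivity))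
    by_cases hz : (z : ℂ) ∈ K
    · exact le_max_of_le_left (hw hz)
    · exact le_max_of_le_right (hKf z ⟨z.2, hz⟩).le
  rcases le_max_iff.mp h with h | h
  · exact h
  · linarith

/-- Adding a small multiple of a function that vanishes at the peak point of `f₀` does not change
the norm of `f₀` to first order. -/
theorem Hv0.exists_norm_add_smul_le {f₀ f : Hv0 v} {z : ℂ} (hz : z ∈ U)
    (hpeak : ∀ w ∈ U, w ≠ z → v w * ‖f₀ w‖ < v z * ‖f₀ z‖) (hf₀ : 0 < v z * ‖f₀ z‖)
    (hfz : f z = 0) {ε : ℝ} (hε : 0 < ε) :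
    ∃ t : ℝ, 0 < t ∧ ‖f₀ + (t : ℂ) • f‖ ≤ v z * ‖f₀ z‖ + t * ε := by
  set N := v z * ‖f₀ z‖ with hN
  obtain ⟨K, hKU, hK, hKf⟩ := f₀.2 (N / 2) (half_pos hf₀)
  obtain ⟨O, hO, hzO, hOf⟩ : ∃ O : Set ℂ, IsOpen O ∧ z ∈ O ∧ ∀ w ∈ O ∩ U, v w * ‖f w‖ < ε := by
    have h := (f.1.continuousOn_weight_mul_norm z hz).eventually_lt_const
      (u := ε) (by simpa [hfz] using hε)
    obtain ⟨O, hO, hzO, h⟩ := mem_nhdsWithin.mp h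
    exact ⟨O, hO, hzO, fun w hw => h hw⟩
  obtain ⟨δ, hδ, hδf⟩ : ∃ δ > 0, ∀ w ∈ U, w ∉ O → v w * ‖f₀ w‖ ≤ N - δ := by
    rcases (K \ O).eq_empty_or_nonempty with he | hne
    · refine ⟨N / 2, by positivity, fun w hw hwO => ?_⟩
      have : w ∉ K := fun h => by
        have : w ∈ K \ O := ⟨h, hwO⟩
        rw [he] at this
        exact this
      linarith [hKf w ⟨hw, this⟩]
    · obtain ⟨x, hx, hmax⟩ := (hK.diff hO).exists_isMaxOn hne
        (f₀.1.continuousOn_weight_mul_norm.mono (sdiff_subset.trans hKU))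
      have hxz : x ≠ z := fun h => hx.2 (h ▸ hzO)
      have hxN := hpeak x (hKU hx.1) hxz
      refine ⟨min (N / 2) (N - v x * ‖f₀ x‖), lt_min (by positivity) (by linarith),
        fun w hw hwO => ?_⟩
      by_cases hwK : w ∈ K
      · have h1 : v w * ‖f₀ w‖ ≤ v x * ‖f₀ x‖ := hmax ⟨hwK, hwO⟩
        linarith [min_le_right (N / 2) (N - v x * ‖f₀ x‖)]
      · linarith [hKf w ⟨hw, hwK⟩, min_le_left (N / 2) (N - v x * ‖f₀ x‖)]
  have hC : 0 < ‖f‖ + 1 := by positivity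
  refine ⟨δ / (‖f‖ + 1), by positivity, ?_⟩
  set t := δ / (‖f‖ + 1) with ht
  have htpos : 0 < t := by positivity
  have htC : t * ‖f‖ ≤ δ := by
    rw [ht, div_mul_eq_mul_div, div_le_iff₀ hC]
    nlinarith
  refine Real.iSup_le (fun w => ?_) (by positivity)
  have hle : v w * ‖f₀ w + (t : ℂ) * f w‖ ≤ v w * ‖f₀ w‖ + t * (v w * ‖f w‖) := by
    calc v w * ‖f₀ w + (t : ℂ) * f w‖ ≤ v w * (‖f₀ w‖ + ‖(t : ℂ) * f w‖) :=
          mul_le_mul_of_nonneg_left (norm_add_le _ _) (v.pos' w w.2).le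
      _ = _ := by rw [norm_mul, Complex.norm_real, Real.norm_of_nonneg htpos.le]; ring
  refine hle.trans ?_
  by_cases hw : (w : ℂ) ∈ O
  · have h1 : v w * ‖f₀ w‖ ≤ N := by
      by_cases hwz : (w : ℂ) = z
      · rw [hwz]
      · exact (hpeak w w.2 hwz).le
    have h2 := hOf w ⟨hw, w.2⟩
    nlinarith
  · have h1 := hδf w w.2 hw
    have h2 : v w * ‖f w‖ ≤ ‖f‖ := f.1.le_norm w.2
    nlinarith [mul_pos htpos hε]

/-- The norm of `H_{v_o}(U)` is smooth at a function that peaks at a single point `z`: evaluation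
at `z` spans the functionals that attain their norm there. -/
theorem Hv0.support_unique {f₀ : Hv0 v} {z : ℂ} (hz : z ∈ U)
    (hpeak : ∀ w ∈ U, w ≠ z → v w * ‖f₀ w‖ < v z * ‖f₀ z‖) (hf₀ : 0 < v z * ‖f₀ z‖)
    (M : Hv0 v →ₗ[ℂ] ℂ) (hM : ∀ f, ‖M f‖ ≤ ‖f‖) (hM₀ : ‖M f₀‖ = v z * ‖f₀ z‖) (f : Hv0 v) :
    M f * f₀ z = M f₀ * f z := by
  set N := v z * ‖f₀ z‖ with hN
  -- Functions vanishing at `z` are in the kernel of `M`; then subtract a multiple of `f₀` from `f`.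
  have key : ∀ f : Hv0 v, f z = 0 → ((starRingEnd ℂ) (M f₀) * M f).re ≤ 0 := by
    intro f hfz
    refine le_of_forall_pos_le_add fun ε hε => ?_
    obtain ⟨t, ht, hle⟩ := Hv0.exists_norm_add_smul_le hz hpeak hf₀ hfz
      (ε := ε / N) (by positivity)
    have h1 : ((starRingEnd ℂ) (M f₀) * M (f₀ + (t : ℂ) • f)).re ≤ N * (N + t * (ε / N)) := by
      refine (Complex.re_le_norm _).trans ?_
      rw [norm_mul, RCLike.norm_conj, hM₀]
      exact mul_le_mul_of_nonneg_left ((hM _).trans hle) hf₀.le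
    have h2 : ((starRingEnd ℂ) (M f₀) * M (f₀ + (t : ℂ) • f)).re
        = N ^ 2 + t * ((starRingEnd ℂ) (M f₀) * M f).re := by
      rw [map_add, map_smul, smul_eq_mul, mul_add, mul_left_comm, Complex.add_re,
        Complex.re_ofReal_mul, mul_comm, Complex.mul_conj, Complex.ofReal_re,
        Complex.normSq_eq_norm_sq, hM₀]
    have h3 : N * (N + t * (ε / N)) = N ^ 2 + t * ε := by field_simp
    rw [h2, h3] at h1
    rw [zero_add]
    exact le_of_mul_le_mul_left (by linarith) ht
  have hf₀z : f₀ z ≠ 0 := fun h => by simp [hN, h] at hf₀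
  have hMne : M f₀ ≠ 0 := norm_pos_iff.mp (hM₀ ▸ hf₀)
  set f₁ : Hv0 v := f₀ z • f - f z • f₀ with hf₁
  have hf₁z : f₁ z = 0 := by
    change f₀ z * f z - f z * f₀ z = 0
    ring
  have h := key ((M f₀ * (starRingEnd ℂ) (M f₁)) • f₁) (by
    change _ * f₁ z = 0
    rw [hf₁z, mul_zero])
  have h' : (starRingEnd ℂ) (M f₀) * M ((M f₀ * (starRingEnd ℂ) (M f₁)) • f₁)
      = ((Complex.normSq (M f₀) * Complex.normSq (M f₁) : ℝ) : ℂ) := by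
    rw [map_smul, smul_eq_mul, Complex.ofReal_mul, ← Complex.mul_conj, ← Complex.mul_conj]
    ring
  rw [h', Complex.ofReal_re] at h
  have h0 : M f₁ = 0 := by
    by_contra hne
    exact absurd h (not_le.mpr (mul_pos (Complex.normSq_pos.mpr hMne) (Complex.normSq_pos.mpr hne)))
  rw [hf₁, map_sub, map_smul, map_smul, smul_eq_mul, smul_eq_mul] at h0
  linear_combination h0

end Support

/-! ### Peak functions on the disc -/

section Peak

variable {β : ℝ}

theorem powWeight_apply (hβ : 1 ≤ β) (z : ℂ) : powWeight β hβ z = 1 - ‖z‖ ^ β := rfl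

theorem exists_radius_one_sub_rpow_lt {β ε : ℝ} (hε : 0 < ε) :
    ∃ ρ < 1, ∀ r, ρ < r → r < 1 → 1 - r ^ β < ε := by
  have hc : ContinuousAt (fun r : ℝ => 1 - r ^ β) 1 :=
    continuousAt_const.sub (Real.continuousAt_rpow_const _ _ (Or.inl one_ne_zero))
  have h := hc.eventually_lt_const (u := ε) (by simpa using hε)
  obtain ⟨δ, hδ, h⟩ := Metric.eventually_nhds_iff.mp h
  refine ⟨1 - δ, by linarith, fun r h1 h2 => h ?_⟩
  rw [Real.dist_eq, abs_lt]
  constructor <;> linarith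

open Classical in
/-- A bounded holomorphic function on the disc as an element of `H_{v_o}`. -/
noncomputable def Hv0.ofBounded (hβ : 1 ≤ β) (F : ℂ → ℂ) (hF : DifferentiableOn ℂ F (ball 0 1))
    (hb : ∃ C, ∀ z ∈ ball (0 : ℂ) 1, ‖F z‖ ≤ C) : Hv0 (powWeight β hβ) :=
  ⟨⟨fun z => if z ∈ ball (0 : ℂ) 1 then F z else 0,
    hF.congr fun z hz => if_pos hz, fun z hz => if_neg hz, by
      obtain ⟨C, hC⟩ := hb
      refine ⟨C, fun z hz => ?_⟩
      have h1 : powWeight β hβ z ≤ 1 := by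
        have := Real.rpow_nonneg (norm_nonneg z) β
        rw [powWeight_apply]
        linarith
      change powWeight β hβ z * ‖if z ∈ ball (0 : ℂ) 1 then F z else 0‖ ≤ C
      rw [if_pos hz]
      exact (mul_le_of_le_one_left (norm_nonneg _) h1).trans (hC z hz)⟩, by
    obtain ⟨C, hC⟩ := hb
    have hC0 : 0 ≤ C := (norm_nonneg _).trans (hC 0 (by simp))
    intro ε hε
    obtain ⟨ρ, hρ, h⟩ := exists_radius_one_sub_rpow_lt (β := β) (ε := ε / (C + 1)) (by positivity)
    refine ⟨closedBall 0 ρ, closedBall_subset_ball hρ, isCompact_closedBall _ _, fun z hz => ?_⟩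
    have hz1 : ‖z‖ < 1 := mem_ball_zero_iff.mp hz.1
    have hz2 : ρ < ‖z‖ := by simpa using hz.2
    have h1 := h _ hz2 hz1
    rw [lt_div_iff₀ (by positivity)] at h1
    change (powWeight β hβ) z * ‖if z ∈ ball (0 : ℂ) 1 then F z else 0‖ < ε
    rw [if_pos hz.1]
    have hp := (powWeight β hβ).pos' z hz.1
    change 0 < 1 - ‖z‖ ^ β at hp
    rw [powWeight_apply]
    have := mul_le_mul_of_nonneg_left (hC z hz.1) hp.le
    nlinarith⟩

theorem Hv0.ofBounded_apply (hβ : 1 ≤ β) {F : ℂ → ℂ} (hF : DifferentiableOn ℂ F (ball 0 1))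
    (hb : ∃ C, ∀ z ∈ ball (0 : ℂ) 1, ‖F z‖ ≤ C) {z : ℂ} (hz : z ∈ ball (0 : ℂ) 1) :
    (Hv0.ofBounded hβ F hF hb) z = F z := if_pos hz

/-- The tangent line of the convex function `x ↦ x ^ β` at `r`, combined with `1 + y < exp y`. -/
theorem one_sub_rpow_mul_exp_lt (hβ : 1 ≤ β) {r x m : ℝ} (hr : 0 < r) (hr1 : r < 1)
    (hx : 0 ≤ x) (hxr : x ≠ r)
    (hm : m * (1 - r ^ β) = β * r ^ β / r) :
    (1 - x ^ β) * Real.exp (m * x) < (1 - r ^ β) * Real.exp (m * r) := by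
  have hrβ : r ^ β < 1 := Real.rpow_lt_one hr.le hr1 (by linarith)
  have hrpos : 0 < r ^ β := Real.rpow_pos_of_pos hr β
  have hmpos : 0 < m := by
    have : 0 < m * (1 - r ^ β) := by rw [hm]; positivity
    exact pos_of_mul_pos_left this (by linarith)
  have hbern := one_add_mul_self_le_rpow_one_add (s := x / r - 1) (by
    have : 0 ≤ x / r := by positivity
    linarith) hβ
  rw [add_sub_cancel, Real.div_rpow hx hr.le, le_div_iff₀ hrpos] at hbern
  have h1 : 1 - x ^ β ≤ (1 - r ^ β) * (m * (r - x) + 1) := by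
    have : (1 - r ^ β) * (m * (r - x) + 1) = 1 - (1 + β * (x / r - 1)) * r ^ β := by
      have : (1 - r ^ β) * (m * (r - x) + 1) = (m * (1 - r ^ β)) * (r - x) + (1 - r ^ β) := by ring
      rw [this, hm]
      field_simp
      ring
    linarith
  have h2 : m * (r - x) + 1 < Real.exp (m * (r - x)) :=
    Real.add_one_lt_exp (mul_ne_zero hmpos.ne' (sub_ne_zero.mpr hxr.symm))
  have h3 : 1 - x ^ β < (1 - r ^ β) * Real.exp (m * (r - x)) :=
    h1.trans_lt (mul_lt_mul_of_pos_left h2 (by linarith))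
  calc (1 - x ^ β) * Real.exp (m * x)
      < (1 - r ^ β) * Real.exp (m * (r - x)) * Real.exp (m * x) :=
        mul_lt_mul_of_pos_right h3 (Real.exp_pos _)
    _ = _ := by rw [mul_assoc, ← Real.exp_add]; ring_nf

/-- Every point of the disc is a peak point. Since `β ≥ 1`, the function `-log v` is convex on the
disc as a subset of the plane, so the exponential of a complex-linear function whose real part is
a supporting real-linear function peaks at the point of support. -/
theorem exists_peak (hβ : 1 ≤ β) {a : ℂ} (ha : a ∈ ball (0 : ℂ) 1) :
    ∃ f₀ : Hv0 (powWeight β hβ), f₀ a ≠ 0 ∧ ∀ w ∈ ball (0 : ℂ) 1, w ≠ a →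
      powWeight β hβ w * ‖f₀ w‖ < powWeight β hβ a * ‖f₀ a‖ := by
  have ha1 : ‖a‖ < 1 := mem_ball_zero_iff.mp ha
  have hβ0 : 0 < β := by linarith
  have hexp : ∀ c : ℂ, ∃ C, ∀ z ∈ ball (0 : ℂ) 1, ‖Complex.exp (c * z)‖ ≤ C := by
    refine fun c => ⟨Real.exp ‖c‖, fun z hz => ?_⟩
    rw [Complex.norm_exp]
    refine Real.exp_le_exp.mpr ((Complex.re_le_norm _).trans ?_)
    rw [norm_mul]
    exact mul_le_of_le_one_right (norm_nonneg _) (mem_ball_zero_iff.mp hz).le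
  have hdiff : ∀ c : ℂ, DifferentiableOn ℂ (fun z => Complex.exp (c * z)) (ball 0 1) := by
    intro c; fun_prop
  rcases eq_or_ne a 0 with rfl | ha0
  · refine ⟨Hv0.ofBounded hβ _ (hdiff 0) (hexp 0), ?_, fun w hw hw0 => ?_⟩
    · rw [Hv0.ofBounded_apply hβ _ _ ha]
      exact Complex.exp_ne_zero _
    · rw [Hv0.ofBounded_apply hβ _ _ ha, Hv0.ofBounded_apply hβ _ _ hw]
      have := Real.rpow_pos_of_pos (norm_pos_iff.mpr hw0) β
      simp only [powWeight_apply, zero_mul, Complex.exp_zero, norm_one, norm_zero,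
        Real.zero_rpow hβ0.ne']
      linarith
  · have hr : 0 < ‖a‖ := norm_pos_iff.mpr ha0
    have hrβ : ‖a‖ ^ β < 1 := Real.rpow_lt_one hr.le ha1 hβ0
    obtain ⟨m, hm⟩ : ∃ m : ℝ, m * (1 - ‖a‖ ^ β) = β * ‖a‖ ^ β / ‖a‖ :=
      ⟨_, div_mul_cancel₀ _ (by linarith : 1 - ‖a‖ ^ β ≠ 0)⟩
    have hmpos : 0 < m := by
      have : 0 < m * (1 - ‖a‖ ^ β) := by rw [hm]; positivity
      exact pos_of_mul_pos_left this (by linarith)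
    set c : ℂ := (m / ‖a‖ : ℝ) * (starRingEnd ℂ) a with hc
    have hnorm : ∀ z, ‖Complex.exp (c * z)‖ = Real.exp (m / ‖a‖ * ((starRingEnd ℂ) a * z).re) := by
      intro z
      rw [Complex.norm_exp, hc, mul_assoc, Complex.re_ofReal_mul]
    have hval : m / ‖a‖ * ((starRingEnd ℂ) a * a).re = m * ‖a‖ := by
      rw [mul_comm _ a, Complex.mul_conj, Complex.ofReal_re, Complex.normSq_eq_norm_sq]
      field_simp
    refine ⟨Hv0.ofBounded hβ _ (hdiff c) (hexp c), ?_, fun w hw hwa => ?_⟩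
    · rw [Hv0.ofBounded_apply hβ _ _ ha]
      exact Complex.exp_ne_zero _
    · rw [Hv0.ofBounded_apply hβ _ _ ha, Hv0.ofBounded_apply hβ _ _ hw, hnorm, hnorm, hval]
      have hw1 : ‖w‖ < 1 := mem_ball_zero_iff.mp hw
      have hwβ : ‖w‖ ^ β < 1 := Real.rpow_lt_one (norm_nonneg _) hw1 hβ0
      have hre : ((starRingEnd ℂ) a * w).re ≤ ‖a‖ * ‖w‖ := by
        refine (Complex.re_le_norm _).trans ?_
        rw [norm_mul, RCLike.norm_conj]
      have hle : m / ‖a‖ * ((starRingEnd ℂ) a * w).re ≤ m * ‖w‖ := by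
        calc _ ≤ m / ‖a‖ * (‖a‖ * ‖w‖) := mul_le_mul_of_nonneg_left hre (by positivity)
          _ = _ := by field_simp
      simp only [powWeight_apply]
      by_cases hwr : ‖w‖ = ‖a‖
      · -- On the circle through `a`, equality in `Re (conj a * w) ≤ |a| |w|` forces `w = a`.
        rw [hwr]
        refine mul_lt_mul_of_pos_left (Real.exp_lt_exp.mpr ?_) (by linarith)
        refine lt_of_le_of_ne (by rwa [hwr] at hle) fun heq => hwa ?_
        have h1 : ((starRingEnd ℂ) a * w).re = ‖a‖ ^ 2 := by
          field_simp at heq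
          exact heq
        have h2 : ‖w - a‖ ^ 2 = 0 := by
          rw [← Complex.normSq_eq_norm_sq, Complex.normSq_sub, Complex.normSq_eq_norm_sq,
            Complex.normSq_eq_norm_sq, mul_comm w, h1, hwr]
          ring
        exact sub_eq_zero.mp (norm_eq_zero.mp (pow_eq_zero_iff two_ne_zero |>.mp h2))
      · exact (mul_le_mul_of_nonneg_left (Real.exp_le_exp.mpr hle) (by linarith)).trans_lt
          (one_sub_rpow_mul_exp_lt hβ hr ha1 (norm_nonneg _) hwr hm)

/-- The adjoint of an isometry maps some multiple of a point evaluation to any given point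
evaluation. -/
theorem exists_preimage_point (hβ : 1 ≤ β)
    (T : Hv0 (powWeight β hβ) →ₗᵢ[ℂ] Hv0 (powWeight β hβ)) {z : ℂ}
    (hz : z ∈ ball (0 : ℂ) 1) :
    ∃ w ∈ ball (0 : ℂ) 1, ∃ l : ℂ, powWeight β hβ w * ‖l‖ = powWeight β hβ z ∧
      ∀ f, T f w = l * f z := by
  obtain ⟨f₀, hne, hpeak⟩ := exists_peak hβ hz
  have hvz := (powWeight β hβ).pos' z hz
  have hpos : 0 < powWeight β hβ z * ‖f₀ z‖ := mul_pos hvz (norm_pos_iff.mpr hne)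
  have hnorm : ‖f₀‖ = powWeight β hβ z * ‖f₀ z‖ := by
    refine le_antisymm (Real.iSup_le (fun w => ?_) hpos.le) (f₀.1.le_norm hz)
    by_cases hw : (w : ℂ) = z
    · exact (congrArg (fun u => powWeight β hβ u * ‖f₀ u‖) hw).le
    · exact (hpeak w w.2 hw).le
  obtain ⟨w, hw, hTw⟩ := Hv0.exists_norm_eq (T f₀) (by rw [T.norm_map, hnorm]; exact hpos)
  rw [T.norm_map, hnorm] at hTw
  have hvw := (powWeight β hβ).pos' w hw
  have hvw' : ((powWeight β hβ w : ℝ) : ℂ) ≠ 0 := Complex.ofReal_ne_zero.mpr hvw.ne'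
  let M : Hv0 (powWeight β hβ) →ₗ[ℂ] ℂ :=
    { toFun := fun f => (powWeight β hβ w : ℂ) * T f w
      map_add' := fun f g => by
        rw [map_add]
        change _ * (T f w + T g w) = _
        ring
      map_smul' := fun c f => by
        rw [map_smul]
        change _ * (c * T f w) = c * _
        ring }
  have hMn : ∀ f, ‖M f‖ = powWeight β hβ w * ‖T f w‖ := by
    intro f
    change ‖(powWeight β hβ w : ℂ) * T f w‖ = _
    rw [norm_mul, Complex.norm_real, Real.norm_of_nonneg hvw.le]
  have hM : ∀ f, ‖M f‖ ≤ ‖f‖ := fun f => by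
    rw [hMn, ← T.norm_map f]
    exact (T f).1.le_norm hw
  have hsup := Hv0.support_unique hz hpeak hpos M hM (by rw [hMn, hTw])
  refine ⟨w, hw, T f₀ w / f₀ z, ?_, fun f => ?_⟩
  · rw [norm_div, ← mul_div_assoc, hTw, mul_div_cancel_right₀ _ (norm_pos_iff.mpr hne).ne']
  · have h : (powWeight β hβ w : ℂ) * T f w * f₀ z = (powWeight β hβ w : ℂ) * T f₀ w * f z :=
      hsup f
    rw [div_mul_eq_mul_div, eq_div_iff hne]
    exact mul_left_cancel₀ hvw' (by linear_combination h)

end Peak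

/-! ### Holomorphic maps with a closed set of large image -/

section Baire

open MeasureTheory Filter Topology

theorem exists_ball_injOn {φ : ℂ → ℂ} {x : ℂ} (hφ : AnalyticAt ℂ φ x) (hx : deriv φ x ≠ 0) :
    ∃ R > 0, InjOn φ (ball x R) ∧ ∀ y ∈ ball x R, deriv φ y ≠ 0 := by
  have hs := hφ.hasStrictDerivAt.hasStrictFDerivAt_equiv hx
  have h1 : (hs.toOpenPartialHomeomorph φ).source ∈ 𝓝 x :=
    (hs.toOpenPartialHomeomorph φ).open_source.mem_nhds hs.mem_toOpenPartialHomeomorph_source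
  have h2 : ∀ᶠ y in 𝓝 x, deriv φ y ≠ 0 := hφ.deriv.continuousAt.eventually_ne hx
  obtain ⟨R, hR, h⟩ := Metric.mem_nhds_iff.mp (inter_mem h1 h2)
  exact ⟨R, hR, (hs.toOpenPartialHomeomorph φ).injOn.mono fun y hy => (h hy).1,
    fun y hy => (h hy).2⟩

/-- The critical values are a null set, by Sard's lemma. -/
theorem volume_image_critical {φ : ℂ → ℂ} {s : Set ℂ}
    (hφ : ∀ x ∈ s, DifferentiableAt ℂ φ x) (hs : ∀ x ∈ s, deriv φ x = 0) :
    volume (φ '' s) = 0 := by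
  refine addHaar_image_eq_zero_of_det_fderivWithin_eq_zero volume (f' := fun _ => 0)
    (fun x hx => ?_) (fun x _ => ?_)
  · have h := ((hφ x hx).hasDerivAt.hasFDerivAt).restrictScalars ℝ
    rw [hs x hx] at h
    have h0 : (ContinuousLinearMap.toSpanSingleton ℂ (0 : ℂ)).restrictScalars ℝ = 0 := by
      ext; simp
    rw [h0] at h
    exact h.hasFDerivWithinAt
  · rw [ContinuousLinearMap.det]
    exact LinearMap.det_zero'' (M := ℂ) (R := ℝ)

/-- A relatively closed subset `F` of the domain of a holomorphic map `φ` whose image contains a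
nonempty open set `V` has interior points over `V` at which `φ` is not critical. By Sard's lemma the
critical points of `φ` can be neglected; away from them `φ` is a local homeomorphism, and Baire's
theorem applies to the images of countably many compact pieces of `F`. -/
theorem exists_ball_subset_of_subset_image {φ : ℂ → ℂ} {Ω F V : Set ℂ} (hΩ : IsOpen Ω)
    (hφ : DifferentiableOn ℂ φ Ω) (hFΩ : F ⊆ Ω) (hF : ∀ w ∈ Ω, w ∈ closure F → w ∈ F)
    (hV : IsOpen V) (hVne : V.Nonempty) (hVF : V ⊆ φ '' F) :
    ∃ w r, 0 < r ∧ ball w r ⊆ F ∧ ∀ y ∈ ball w r, φ y ∈ V ∧ deriv φ y ≠ 0 := by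
  classical
  have hcomp : ∀ K ⊆ Ω, IsCompact K → IsCompact (F ∩ K) := by
    intro K hKΩ hK
    have : F ∩ K = closure F ∩ K :=
      Subset.antisymm (inter_subset_inter_left _ subset_closure)
        fun w hw => ⟨hF w (hKΩ hw.2) hw.1, hw.2⟩
    rw [this]
    exact hK.inter_left isClosed_closure
  have hcrit : ∀ K ⊆ Ω, IsCompact K → IsCompact (F ∩ K ∩ {y | deriv φ y = 0}) := by
    intro K hKΩ hK
    have hc := hcomp K hKΩ hK
    have hd : ContinuousOn (deriv φ) (F ∩ K) :=
      ((hφ.deriv hΩ).continuousOn).mono (inter_subset_left.trans hFΩ)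
    exact hc.of_isClosed_subset (hd.preimage_isClosed_of_isClosed hc.isClosed isClosed_singleton)
      inter_subset_left
  have hr : ∀ x : ℂ, ∃ R > 0, x ∈ Ω → ball x R ⊆ Ω ∧
      (deriv φ x ≠ 0 → InjOn φ (ball x R) ∧ ∀ y ∈ ball x R, deriv φ y ≠ 0) := by
    intro x
    by_cases hx : x ∈ Ω
    · obtain ⟨R, hR, h⟩ := Metric.isOpen_iff.mp hΩ x hx
      by_cases hd : deriv φ x = 0
      · exact ⟨R, hR, fun _ => ⟨h, fun h' => absurd hd h'⟩⟩
      · obtain ⟨R', hR', h1, h2⟩ :=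
          exists_ball_injOn (hφ.analyticAt (hΩ.mem_nhds hx)) hd
        exact ⟨min R R', lt_min hR hR', fun _ =>
          ⟨(ball_subset_ball (min_le_left _ _)).trans h, fun _ =>
          ⟨h1.mono (ball_subset_ball (min_le_right _ _)),
            fun y hy => h2 y (ball_subset_ball (min_le_right _ _) hy)⟩⟩⟩
    · exact ⟨1, one_pos, fun h => absurd h hx⟩
  choose R hR hRΩ using hr
  have hhalf : ∀ x, closedBall x (R x / 2) ⊆ ball x (R x) := fun x =>
    closedBall_subset_ball (half_lt_self (hR x))
  have hcov : ∀ s : Set ℂ, ∃ t ⊆ s, t.Countable ∧ s ⊆ ⋃ x ∈ t, closedBall x (R x / 2) := fun s =>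
    TopologicalSpace.countable_cover_nhdsWithin fun x _ =>
      mem_nhdsWithin_of_mem_nhds (closedBall_mem_nhds x (half_pos (hR x)))
  obtain ⟨t₁, ht₁, hc₁, hs₁⟩ := hcov {x | x ∈ Ω ∧ deriv φ x ≠ 0}
  obtain ⟨t₂, ht₂, hc₂, hs₂⟩ := hcov {x | x ∈ Ω ∧ deriv φ x = 0}
  -- The image of `F` is covered by the images `C₁ x` of pieces of `F` on which `φ` is injective and
  -- the sets `C₂ x` of critical values; all are compact, and the latter have empty interior.
  set C₁ : ℂ → Set ℂ := fun x => φ '' (F ∩ closedBall x (R x / 2)) with hC₁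
  set C₂ : ℂ → Set ℂ :=
    fun x => φ '' (F ∩ closedBall x (R x / 2) ∩ {y | deriv φ y = 0}) with hC₂
  have hsub : ∀ x ∈ Ω, closedBall x (R x / 2) ⊆ Ω := fun x hx =>
    (hhalf x).trans (hRΩ x hx).1
  have hdense := dense_sUnion_interior_of_closed
    (S := insert Vᶜ (C₁ '' t₁ ∪ C₂ '' t₂)) (by
      rintro s (rfl | ⟨x, hx, rfl⟩ | ⟨x, hx, rfl⟩)
      · exact hV.isClosed_compl
      · refine ((hcomp _ (hsub x (ht₁ hx).1) (isCompact_closedBall _ _)).image_of_continuousOn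
          (hφ.continuousOn.mono ?_)).isClosed
        exact inter_subset_left.trans hFΩ
      · refine ((hcrit _ (hsub x (ht₂ hx).1) (isCompact_closedBall _ _)).image_of_continuousOn
          (hφ.continuousOn.mono ?_)).isClosed
        exact inter_subset_left.trans (inter_subset_left.trans hFΩ))
    (((hc₁.image _).union (hc₂.image _)).insert _) (by
      refine eq_univ_of_forall fun z => ?_
      by_cases hz : z ∈ V
      · obtain ⟨y, hy, rfl⟩ := hVF hz
        by_cases hd : deriv φ y = 0
        · obtain ⟨x, hx, hyx⟩ := mem_iUnion₂.mp (hs₂ ⟨hFΩ hy, hd⟩)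
          exact ⟨C₂ x, Or.inr (Or.inr ⟨x, hx, rfl⟩), y, ⟨⟨hy, hyx⟩, hd⟩, rfl⟩
        · obtain ⟨x, hx, hyx⟩ := mem_iUnion₂.mp (hs₁ ⟨hFΩ hy, hd⟩)
          exact ⟨C₁ x, Or.inr (Or.inl ⟨x, hx, rfl⟩), y, ⟨hy, hyx⟩, rfl⟩
      · exact ⟨Vᶜ, Or.inl rfl, hz⟩)
  obtain ⟨z, hzV, hz⟩ := hdense.inter_open_nonempty V hV hVne
  obtain ⟨s, hs, hzs⟩ := mem_iUnion₂.mp hz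
  rcases hs with rfl | ⟨x, hx, rfl⟩ | ⟨x, hx, rfl⟩
  · exact absurd hzV (interior_subset hzs)
  · obtain ⟨w, hw, rfl⟩ := interior_subset hzs
    have hxΩ := (ht₁ hx).1
    obtain ⟨hball, hinj⟩ := hRΩ x hxΩ
    obtain ⟨hinj, hne⟩ := hinj (ht₁ hx).2
    have hwR : w ∈ ball x (R x) := hhalf x hw.2
    have hcont : ContinuousAt φ w :=
      (hφ.differentiableAt (hΩ.mem_nhds (hFΩ hw.1))).continuousAt
    have h1 : φ ⁻¹' (interior (C₁ x) ∩ V) ∈ 𝓝 w :=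
      hcont ((isOpen_interior.inter hV).mem_nhds ⟨hzs, hzV⟩)
    obtain ⟨r, hr, hrs⟩ := Metric.mem_nhds_iff.mp (inter_mem h1 (isOpen_ball.mem_nhds hwR))
    refine ⟨w, r, hr, fun y hy => ?_, fun y hy => ⟨(hrs hy).1.2, hne y (hrs hy).2⟩⟩
    obtain ⟨y', hy', heq⟩ := interior_subset (hrs hy).1.1
    exact hinj (hhalf x hy'.2) (hrs hy).2 heq ▸ hy'.1
  · have h0 : volume (C₂ x) = 0 := volume_image_critical
      (fun y hy => hφ.differentiableAt (hΩ.mem_nhds (hFΩ hy.1.1))) fun y hy => hy.2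
    have hpos := isOpen_interior.measure_pos volume (⟨z, hzs⟩ : (interior (C₂ x)).Nonempty)
    exact absurd (measure_mono_null interior_subset h0) hpos.ne'

end Baire

/-! ### Identities between sums of squared moduli of holomorphic functions -/

section Hermitian

open ComplexConjugate Topology

theorem hasDerivAt_conj_mul_line {F H : ℂ → ℂ} {z F' H' : ℂ} (hF : HasDerivAt F F' z)
    (hH : HasDerivAt H H' z) (e : ℂ) :
    HasDerivAt (fun t : ℝ => conj (F (z + t * e)) * H (z + t * e))
      (conj (F' * e) * H z + conj (F z) * (H' * e)) 0 := by
  have hl : HasDerivAt (fun t : ℝ => z + t * e) e 0 := by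
    have := ((Complex.ofRealCLM.hasDerivAt (x := (0 : ℝ))).mul_const e).const_add z
    simpa using this
  have hF' : HasDerivAt (fun t : ℝ => F (z + t * e)) (F' * e) 0 := by
    rw [mul_comm]
    exact HasDerivAt.scomp (h := fun t : ℝ => z + t * e) (0 : ℝ) (by simpa using hF) hl
  have hH' : HasDerivAt (fun t : ℝ => H (z + t * e)) (H' * e) 0 := by
    rw [mul_comm]
    exact HasDerivAt.scomp (h := fun t : ℝ => z + t * e) (0 : ℝ) (by simpa using hH) hl
  have h := hF'.star.mul hH'
  simp only [Complex.ofReal_zero, zero_mul, add_zero] at h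
  exact h

/-- Differentiating a sesquilinear identity between holomorphic functions separates into its
antiholomorphic and its holomorphic part. -/
theorem sum_conj_mul_deriv_eq_zero {ι : Type*} [Fintype ι] {F H : ι → ℂ → ℂ} {W : Set ℂ}
    (hW : IsOpen W) (hF : ∀ i, DifferentiableOn ℂ (F i) W) (hH : ∀ i, DifferentiableOn ℂ (H i) W)
    {C : ℂ} (h : ∀ w ∈ W, ∑ i, conj (F i w) * H i w = C) {z : ℂ} (hz : z ∈ W) :
    ∑ i, conj (deriv (F i) z) * H i z = 0 ∧ ∑ i, conj (F i z) * deriv (H i) z = 0 := by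
  have hd : ∀ e : ℂ, conj e * (∑ i, conj (deriv (F i) z) * H i z)
      + e * (∑ i, conj (F i z) * deriv (H i) z) = 0 := by
    intro e
    have h1 : HasDerivAt (fun t : ℝ => ∑ i, conj (F i (z + t * e)) * H i (z + t * e))
        (∑ i, (conj (deriv (F i) z * e) * H i z + conj (F i z) * (deriv (H i) z * e))) 0 :=
      HasDerivAt.fun_sum fun i _ => hasDerivAt_conj_mul_line
        ((hF i).differentiableAt (hW.mem_nhds hz)).hasDerivAt
        ((hH i).differentiableAt (hW.mem_nhds hz)).hasDerivAt e
    have hev : ∀ᶠ t : ℝ in 𝓝 0, z + t * e ∈ W := by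
      have hc : Continuous fun t : ℝ => z + t * e := by fun_prop
      exact hc.continuousAt.eventually_mem (hW.mem_nhds (by simpa using hz))
    have h2 : HasDerivAt (fun t : ℝ => ∑ i, conj (F i (z + t * e)) * H i (z + t * e)) 0 0 :=
      (hasDerivAt_const (0 : ℝ) C).congr_of_eventuallyEq (hev.mono fun t ht => h _ ht)
    have h3 := h1.unique h2
    rw [Finset.sum_add_distrib] at h3
    rw [Finset.mul_sum, Finset.mul_sum, ← h3]
    congr 1 <;> refine Finset.sum_congr rfl fun i _ => ?_
    · rw [map_mul]; ring
    · ring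
  have h1 := hd 1
  have h2 := hd Complex.I
  rw [map_one, one_mul, one_mul] at h1
  rw [Complex.conj_I] at h2
  have h3 := congrArg (Complex.I * ·) h2
  simp only [mul_zero] at h3
  constructor
  · linear_combination (1 / 2) * h1 + (1 / 2) * h3 + (1 / 2) *
      (∑ i, conj (deriv (F i) z) * H i z - ∑ i, conj (F i z) * deriv (H i) z) * Complex.I_mul_I
  · linear_combination (1 / 2) * h1 - (1 / 2) * h3 - (1 / 2) *
      (∑ i, conj (deriv (F i) z) * H i z - ∑ i, conj (F i z) * deriv (H i) z) * Complex.I_mul_I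

/-- First- and second-order consequences of `|A|² + |G|² - |P|² = C` for holomorphic `A, G, P`. -/
theorem conj_mul_deriv_of_norm_sq_eq {A G P : ℂ → ℂ} {W : Set ℂ} (hW : IsOpen W)
    (hA : DifferentiableOn ℂ A W) (hG : DifferentiableOn ℂ G W) (hP : DifferentiableOn ℂ P W)
    {C : ℝ} (h : ∀ w ∈ W, ‖A w‖ ^ 2 + ‖G w‖ ^ 2 - ‖P w‖ ^ 2 = C) {z : ℂ} (hz : z ∈ W) :
    conj (A z) * deriv A z + conj (G z) * deriv G z = conj (P z) * deriv P z ∧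
      ‖deriv A z‖ ^ 2 + ‖deriv G z‖ ^ 2 = ‖deriv P z‖ ^ 2 := by
  -- Differentiate `∑ i, conj (F i) * H i = C` twice, with the sign of `|P|²` put into `H`.
  set F : Fin 3 → ℂ → ℂ := ![A, G, P] with hFdef
  set H : Fin 3 → ℂ → ℂ := ![A, G, -P] with hHdef
  have hF : ∀ i, DifferentiableOn ℂ (F i) W := by
    intro i; fin_cases i <;> assumption
  have hH : ∀ i, DifferentiableOn ℂ (H i) W := by
    intro i
    fin_cases i
    · exact hA
    · exact hG
    · exact hP.neg
  have hH' : ∀ i, DifferentiableOn ℂ (deriv (H i)) W := fun i => (hH i).deriv hW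
  have h0 : ∀ w ∈ W, ∑ i, conj (F i w) * H i w = (C : ℂ) := by
    intro w hw
    rw [← h w hw, Fin.sum_univ_three]
    simp only [hFdef, hHdef, Matrix.cons_val, Pi.neg_apply]
    push_cast
    rw [← Complex.conj_mul', ← Complex.conj_mul', ← Complex.conj_mul']
    ring
  have h1 : ∀ w ∈ W, ∑ i, conj (F i w) * deriv (H i) w = 0 := fun w hw =>
    (sum_conj_mul_deriv_eq_zero hW hF hH h0 hw).2
  have h2 := (sum_conj_mul_deriv_eq_zero hW hF hH' h1 hz).1
  have h1 := h1 z hz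
  rw [Fin.sum_univ_three] at h1 h2
  simp only [hFdef, hHdef, Matrix.cons_val, deriv.neg'] at h1 h2
  refine ⟨by linear_combination h1, ?_⟩
  have h3 : ((‖deriv A z‖ ^ 2 + ‖deriv G z‖ ^ 2 : ℝ) : ℂ) = ((‖deriv P z‖ ^ 2 : ℝ) : ℂ) := by
    push_cast
    rw [← Complex.conj_mul', ← Complex.conj_mul', ← Complex.conj_mul']
    linear_combination h2
  exact_mod_cast h3

/-- If `|A|² + |G|² = 1 + |P|²` for holomorphic functions on a domain, then `(A, G)` is the image
of `(P, 1)` under a constant unitary matrix. -/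
theorem exists_unitary_of_norm_sq_eq {A G P : ℂ → ℂ} {W : Set ℂ} (hW : IsOpen W)
    (hWc : IsPreconnected W) (hWne : W.Nonempty)
    (hA : DifferentiableOn ℂ A W) (hG : DifferentiableOn ℂ G W) (hP : DifferentiableOn ℂ P W)
    (h : ∀ w ∈ W, ‖A w‖ ^ 2 + ‖G w‖ ^ 2 - ‖P w‖ ^ 2 = 1) (hA' : ∀ w ∈ W, deriv A w ≠ 0) :
    ∃ x y a c : ℂ, ‖x‖ ^ 2 + ‖y‖ ^ 2 = 1 ∧ ‖a‖ ^ 2 + ‖c‖ ^ 2 = 1 ∧ x * conj a + y * conj c = 0 ∧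
      ∀ w ∈ W, A w = x * P w + a ∧ G w = y * P w + c := by
  obtain ⟨z, hz⟩ := hWne
  have hd := fun w (hw : w ∈ W) => conj_mul_deriv_of_norm_sq_eq hW hA hG hP h hw
  have hP' : ∀ w ∈ W, deriv P w ≠ 0 := fun w hw h0 => by
    have h1 := (hd w hw).2
    rw [h0, norm_zero] at h1
    have h2 : 0 < ‖deriv A w‖ := norm_pos_iff.mpr (hA' w hw)
    nlinarith [sq_nonneg ‖deriv G w‖]
  have hX : DifferentiableOn ℂ (fun w => deriv A w / deriv P w) W :=
    (hA.deriv hW).div (hP.deriv hW) hP'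
  have hY : DifferentiableOn ℂ (fun w => deriv G w / deriv P w) W :=
    (hG.deriv hW).div (hP.deriv hW) hP'
  have hXY : ∀ w ∈ W, ‖deriv A w / deriv P w‖ ^ 2 + ‖deriv G w / deriv P w‖ ^ 2
      - ‖(0 : ℂ)‖ ^ 2 = 1 := by
    intro w hw
    have h2 : 0 < ‖deriv P w‖ := norm_pos_iff.mpr (hP' w hw)
    rw [norm_div, norm_div, norm_zero, div_pow, div_pow, ← add_div, (hd w hw).2,
      div_self (by positivity)]
    norm_num
  have hXY' := fun w (hw : w ∈ W) =>
    (conj_mul_deriv_of_norm_sq_eq (P := fun _ => 0) hW hX hY (differentiableOn_const 0) hXY hw).2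
  have hX0 : EqOn (deriv fun w => deriv A w / deriv P w) 0 W := fun w hw => by
    have h1 := hXY' w hw
    rw [deriv_const, norm_zero] at h1
    exact norm_eq_zero.mp (pow_eq_zero_iff two_ne_zero |>.mp
      (le_antisymm (by nlinarith [sq_nonneg ‖deriv (fun w => deriv G w / deriv P w) w‖])
        (sq_nonneg _)))
  have hY0 : EqOn (deriv fun w => deriv G w / deriv P w) 0 W := fun w hw => by
    have h1 := hXY' w hw
    rw [deriv_const, norm_zero] at h1
    exact norm_eq_zero.mp (pow_eq_zero_iff two_ne_zero |>.mp
      (le_antisymm (by nlinarith [sq_nonneg ‖deriv (fun w => deriv A w / deriv P w) w‖])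
        (sq_nonneg _)))
  obtain ⟨x, hx⟩ := hW.exists_is_const_of_deriv_eq_zero hWc hX hX0
  obtain ⟨y, hy⟩ := hW.exists_is_const_of_deriv_eq_zero hWc hY hY0
  have hx' : ∀ w ∈ W, deriv A w = x * deriv P w := fun w hw => (div_eq_iff (hP' w hw)).mp (hx w hw)
  have hy' : ∀ w ∈ W, deriv G w = y * deriv P w := fun w hw => (div_eq_iff (hP' w hw)).mp (hy w hw)
  have haff : ∀ {f : ℂ → ℂ} {k : ℂ}, DifferentiableOn ℂ f W →
      (∀ w ∈ W, deriv f w = k * deriv P w) → ∃ b, ∀ w ∈ W, f w = k * P w + b := by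
    intro f k hf hfk
    obtain ⟨b, hb⟩ := hW.exists_is_const_of_deriv_eq_zero hWc (hf.sub (hP.const_mul k))
      (fun w hw => by
        have h1 := (hf.differentiableAt (hW.mem_nhds hw))
        have h2 := (hP.differentiableAt (hW.mem_nhds hw))
        have h3 := (h1.hasDerivAt.sub (h2.hasDerivAt.const_mul k)).deriv
        rw [hfk w hw, sub_self] at h3
        exact h3)
    exact ⟨b, fun w hw => by
      have h1 : f w - k * P w = b := hb w hw
      linear_combination h1⟩
  obtain ⟨a, ha⟩ := haff hA hx'
  obtain ⟨c, hc⟩ := haff hG hy'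
  have h1 : ‖x‖ ^ 2 + ‖y‖ ^ 2 = 1 := by
    have h1 := hXY z hz
    rw [hx z hz, hy z hz, norm_zero] at h1
    linarith
  have h1' : x * conj x + y * conj y = 1 := by
    rw [Complex.mul_conj', Complex.mul_conj']
    exact_mod_cast h1
  have h2 : x * conj a + y * conj c = 0 := by
    have h2 := (hd z hz).1
    rw [hx' z hz, hy' z hz, ha z hz, hc z hz, map_add, map_add, map_mul, map_mul] at h2
    refine (mul_eq_zero.mp ?_).resolve_left (hP' z hz)
    linear_combination h2 - deriv P z * conj (P z) * h1'
  refine ⟨x, y, a, c, h1, ?_, h2, fun w hw => ⟨ha w hw, hc w hw⟩⟩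
  have h3 : A z * conj (A z) + G z * conj (G z) - P z * conj (P z) = 1 := by
    rw [Complex.mul_conj', Complex.mul_conj', Complex.mul_conj']
    exact_mod_cast h z hz
  have h2' := congrArg conj h2
  simp only [map_add, map_mul, Complex.conj_conj, map_zero] at h2'
  have h4 : a * conj a + c * conj c = 1 := by
    rw [ha z hz, hc z hz] at h3
    simp only [map_add, map_mul] at h3
    linear_combination h3 - P z * conj (P z) * h1' - P z * h2 - conj (P z) * h2'
  rw [Complex.mul_conj', Complex.mul_conj'] at h4
  exact_mod_cast h4

/-- The identity `1 - |A|² = (1 - |B|²) |G|²` between holomorphic functions forces `A` to be the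
image of `B` under a disc automorphism. -/
theorem exists_moebius_of_norm_sq_eq {A B G : ℂ → ℂ} {W : Set ℂ} (hW : IsOpen W)
    (hWc : IsPreconnected W) (hWne : W.Nonempty)
    (hA : DifferentiableOn ℂ A W) (hB : DifferentiableOn ℂ B W) (hG : DifferentiableOn ℂ G W)
    (h : ∀ w ∈ W, 1 - ‖A w‖ ^ 2 = (1 - ‖B w‖ ^ 2) * ‖G w‖ ^ 2) (hA' : ∀ w ∈ W, deriv A w ≠ 0)
    (hG0 : ∀ w ∈ W, G w ≠ 0) (hB1 : ∀ w ∈ W, ‖B w‖ < 1) :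
    ∃ s η c : ℂ, ‖s‖ < 1 ∧ ‖η‖ = 1 ∧ ‖c‖ ^ 2 = 1 - ‖s‖ ^ 2 ∧
      ∀ w ∈ W, A w * (1 - conj s * B w) = η * (B w - s) ∧ G w * (1 - conj s * B w) = c := by
  obtain ⟨x, y, a, c, h1, h2, h3, hw⟩ := exists_unitary_of_norm_sq_eq (P := fun w => B w * G w)
    hW hWc hWne hA hG (hB.mul hG) (fun w hw => by
      rw [norm_mul, mul_pow]
      linarith [h w hw]) hA'
  have hGc : ∀ w ∈ W, G w * (1 - y * B w) = c := fun w hw' => by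
    linear_combination (hw w hw').2
  have h1' : x * conj x + y * conj y = 1 := by
    rw [Complex.mul_conj', Complex.mul_conj']
    exact_mod_cast h1
  have h2' : a * conj a + c * conj c = 1 := by
    rw [Complex.mul_conj', Complex.mul_conj']
    exact_mod_cast h2
  have h3' := congrArg conj h3
  simp only [map_add, map_mul, Complex.conj_conj, map_zero] at h3'
  have hcx : ‖c‖ ^ 2 = ‖x‖ ^ 2 := by
    have : x * conj x = c * conj c := by
      linear_combination x * conj a * h3' - conj y * c * h3 - x * conj x * h2' + c * conj c * h1'
    rw [Complex.mul_conj', Complex.mul_conj'] at this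
    exact_mod_cast this.symm
  have hc0 : c ≠ 0 := by
    obtain ⟨z, hz⟩ := hWne
    have hy1 : ‖y‖ ≤ 1 := by nlinarith [sq_nonneg ‖x‖, norm_nonneg y]
    rw [← hGc z hz]
    refine mul_ne_zero (hG0 z hz) fun h0 => ?_
    have h5 : ‖y * B z‖ = 1 := by rw [← sub_eq_zero.mp h0, norm_one]
    rw [norm_mul] at h5
    nlinarith [hB1 z hz, norm_nonneg (B z)]
  refine ⟨conj y, x * c - a * y, c, ?_, ?_, ?_, fun w hw' => ?_⟩
  · have : 0 < ‖c‖ ^ 2 := pow_pos (norm_pos_iff.mpr hc0) 2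
    rw [RCLike.norm_conj]
    nlinarith [norm_nonneg y]
  · have : (x * c - a * y) * conj (x * c - a * y) = 1 := by
      simp only [map_sub, map_mul]
      linear_combination (a * conj a + c * conj c) * h1' + h2' - (conj x * a + conj y * c) * h3
    rw [Complex.mul_conj'] at this
    exact (pow_eq_one_iff_of_nonneg (norm_nonneg _) two_ne_zero).mp (by exact_mod_cast this)
  · rw [RCLike.norm_conj]
    linarith
  · rw [Complex.conj_conj]
    refine ⟨?_, hGc w hw'⟩
    rw [(hw w hw').1]
    linear_combination x * B w * hGc w hw' + x * h3' - a * h1'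

end Hermitian

/-! ### From the local identity to a disc automorphism -/

section Rigidity

open ComplexConjugate Topology

theorem eqOn_ball_of_eqOn {F H : ℂ → ℂ} (hF : DifferentiableOn ℂ F (ball 0 1))
    (hH : DifferentiableOn ℂ H (ball 0 1)) {W : Set ℂ} (hW : IsOpen W) (hWne : W.Nonempty)
    (hWsub : W ⊆ ball 0 1) (h : EqOn F H W) : EqOn F H (ball 0 1) := by
  obtain ⟨z, hz⟩ := hWne
  exact (hF.analyticOnNhd isOpen_ball).eqOn_of_preconnected_of_eventuallyEq
    (hH.analyticOnNhd isOpen_ball) (convex_ball 0 1).isPreconnected (hWsub hz)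
    (h.eventuallyEq_of_mem (hW.mem_nhds hz))

theorem isPreconnected_ball_inter_slitPlane :
    IsPreconnected (ball (0 : ℂ) 1 ∩ Complex.slitPlane) := by
  have h1 : StarConvex ℝ (((1 / 2 : ℝ) : ℂ)) (ball (0 : ℂ) 1) :=
    (convex_ball 0 1).starConvex (by simp; norm_num)
  have h2 : StarConvex ℝ (((1 / 2 : ℝ) : ℂ)) Complex.slitPlane :=
    Complex.starConvex_ofReal_slitPlane (by norm_num)
  exact ((h1.inter h2).isPathConnected ⟨by simp; norm_num,
    Complex.ofReal_mem_slitPlane.mpr (by norm_num)⟩).isConnected.isPreconnected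

/-- If `g (1 - y z ^ κ)²` is a nonzero constant on the slit disc for some `g` holomorphic across
the slit and `0 < |y| < 1`, then `z ^ κ` does not jump at the slit, so that `κ` is an integer. -/
theorem exists_int_of_mul_sq_eq {g : ℂ → ℂ} {κ : ℝ} (hκ : 0 < κ) {y C : ℂ}
    (hg : DifferentiableOn ℂ g (ball 0 1)) (hy : y ≠ 0) (hy1 : ‖y‖ < 1) (hC : C ≠ 0)
    (h : ∀ w ∈ ball (0 : ℂ) 1 ∩ Complex.slitPlane, g w * (1 - y * w ^ (κ : ℂ)) ^ 2 = C) :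
    ∃ n : ℤ, κ = n := by
  -- Both sides of the slit are reached along the circle of radius `exp (-1)`, on which
  -- `log (E θ) = -1 + θ i` for `|θ| < π`.
  set E : ℝ → ℂ := fun θ => Complex.exp (-1 + θ * Complex.I) with hE
  set S : ℝ → ℂ := fun θ => y * Complex.exp ((-1 + θ * Complex.I) * κ) with hS
  have hEball : ∀ θ, E θ ∈ ball (0 : ℂ) 1 := fun θ => by
    rw [mem_ball_zero_iff, hE, Complex.norm_exp]
    simp
  have hS1 : ∀ θ, ‖S θ‖ < 1 := fun θ => by
    rw [hS]
    simp only [norm_mul, Complex.norm_exp]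
    refine mul_lt_one_of_nonneg_of_lt_one_left (norm_nonneg _) hy1 (Real.exp_le_one_iff.mpr ?_)
    simp [hκ.le]
  have hcont : Continuous fun θ => g (E θ) * (1 - S θ) ^ 2 := by
    have hEc : Continuous E := by fun_prop
    have hSc : Continuous S := by fun_prop
    exact (hg.continuousOn.comp_continuous hEc hEball).mul ((continuous_const.sub hSc).pow 2)
  have hIoo : ∀ θ ∈ Ioo (-Real.pi) Real.pi, g (E θ) * (1 - S θ) ^ 2 = C := by
    intro θ hθ
    have hlog : Complex.log (E θ) = -1 + θ * Complex.I :=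
      Complex.log_exp (by simpa using hθ.1) (by simpa using hθ.2.le)
    have hslit : E θ ∈ Complex.slitPlane := by
      rw [Complex.mem_slitPlane_iff_arg, ← Complex.log_im, hlog]
      refine ⟨?_, Complex.exp_ne_zero _⟩
      simpa using hθ.2.ne
    rw [← h _ ⟨hEball θ, hslit⟩, Complex.cpow_def_of_ne_zero (Complex.exp_ne_zero _), hlog]
  have hIcc : ∀ θ ∈ Icc (-Real.pi) Real.pi, g (E θ) * (1 - S θ) ^ 2 = C := by
    have hcl : IsClosed {θ : ℝ | g (E θ) * (1 - S θ) ^ 2 = C} :=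
      isClosed_eq hcont continuous_const
    rw [← closure_Ioo (by linarith [Real.pi_pos] : -Real.pi ≠ Real.pi)]
    exact hcl.closure_subset_iff.mpr hIoo
  have hpi := Real.pi_pos
  have h1 := hIcc Real.pi ⟨by linarith, le_rfl⟩
  have h2 := hIcc (-Real.pi) ⟨le_rfl, by linarith⟩
  have hEE : E (-Real.pi) = E Real.pi := by
    simp only [hE, Complex.ofReal_neg, neg_mul, Complex.exp_add, Complex.exp_neg,
      Complex.exp_pi_mul_I]
    norm_num
  rw [hEE] at h2
  have hg0 : g (E Real.pi) ≠ 0 := fun h0 => hC (by rw [← h1, h0, zero_mul])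
  have h3 : (1 - S Real.pi) ^ 2 = (1 - S (-Real.pi)) ^ 2 :=
    mul_left_cancel₀ hg0 (h1.trans h2.symm)
  have h4 : S Real.pi = S (-Real.pi) := by
    rcases sq_eq_sq_iff_eq_or_eq_neg.mp h3 with h4 | h4
    · linear_combination -h4
    · -- The other sign would need two numbers of modulus less than `1` with sum `2`.
      have h5 : S Real.pi + S (-Real.pi) = 2 := by linear_combination -h4
      have h6 := norm_add_le (S Real.pi) (S (-Real.pi))
      rw [h5, Complex.norm_ofNat] at h6
      linarith [hS1 Real.pi, hS1 (-Real.pi)]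
  obtain ⟨n, hn⟩ := Complex.exp_eq_exp_iff_exists_int.mp (mul_left_cancel₀ hy h4)
  refine ⟨n, ?_⟩
  have h7 : (Real.pi * κ : ℂ) = Real.pi * n := by
    push_cast at hn
    have h8 : 2 * Complex.I * (Real.pi * κ : ℂ) = 2 * Complex.I * (Real.pi * n) := by
      linear_combination hn
    exact mul_left_cancel₀ (by simp) h8
  have h8 := mul_left_cancel₀ (Complex.ofReal_ne_zero.mpr hpi.ne') h7
  exact_mod_cast h8

/-- A nontrivial disc automorphism evaluated at `z ^ k`, `k ≥ 2`, is not the `k`-th power of a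
quotient: its zeros are simple. -/
theorem pow_quotient_ne_moebius_pow {g h : ℂ → ℂ} {k : ℕ} (hk : 2 ≤ k) {s η C : ℂ}
    (hg : DifferentiableOn ℂ g (ball 0 1)) (hh : DifferentiableOn ℂ h (ball 0 1))
    (hs : s ≠ 0) (hs1 : ‖s‖ < 1) (hη : η ≠ 0) (hC : C ≠ 0)
    (h1 : ∀ w ∈ ball (0 : ℂ) 1, g w * (1 - conj s * w ^ k) ^ 2 = C)
    (h2 : ∀ w ∈ ball (0 : ℂ) 1, h w ^ k * (1 - conj s * w ^ k) = η * (w ^ k - s) * g w ^ k) :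
    False := by
  -- At a zero `z` of `w ^ k - s`, the left side of `h2` vanishes to order `k ≥ 2`, the right side to
  -- order one.
  obtain ⟨z, hz⟩ := IsAlgClosed.exists_pow_nat_eq s (by omega : 0 < k)
  have hzball : z ∈ ball (0 : ℂ) 1 := by
    rw [mem_ball_zero_iff]
    have : ‖z‖ ^ k < 1 := by rw [← norm_pow, hz]; exact hs1
    exact (pow_lt_one_iff_of_nonneg (norm_nonneg z) (by omega)).mp this
  have hz0 : z ≠ 0 := by
    rintro rfl
    exact hs (by rw [← hz, zero_pow (by omega)])
  have hgz : g z ≠ 0 := fun h0 => hC (by rw [← h1 z hzball, h0, zero_mul])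
  have hone : 1 - conj s * z ^ k ≠ 0 := fun h0 => hC (by rw [← h1 z hzball, h0]; simp)
  have hhz : h z = 0 := by
    have h3 := h2 z hzball
    rw [show η * (z ^ k - s) = 0 by rw [hz, sub_self, mul_zero], zero_mul] at h3
    exact pow_eq_zero_iff (by omega) |>.mp ((mul_eq_zero.mp h3).resolve_right hone)
  have hnhds := isOpen_ball.mem_nhds hzball
  have dg := (hg.differentiableAt hnhds).hasDerivAt
  have dh := (hh.differentiableAt hnhds).hasDerivAt
  have dl := (dh.pow k).mul (((hasDerivAt_pow k z).const_mul (conj s)).const_sub 1)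
  have dr := (((hasDerivAt_pow k z).sub_const s).const_mul η).mul (dg.pow k)
  have h4 := dl.unique (dr.congr_of_eventuallyEq (Filter.eventually_of_mem hnhds h2))
  simp only [Pi.pow_apply, hhz, hz, sub_self, mul_zero, zero_mul, add_zero,
    zero_pow (by omega : k ≠ 0), zero_pow (by omega : k - 1 ≠ 0)] at h4
  have hk0 : (k : ℂ) ≠ 0 := Nat.cast_ne_zero.mpr (by omega)
  exact mul_ne_zero (mul_ne_zero hη (mul_ne_zero hk0 (pow_ne_zero _ hz0))) (pow_ne_zero _ hgz)
    h4.symm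

/-- The analytic core: if `v |g| = v ∘ φ` on some open set, where `φ = h / g` is not critical, then
`φ` agrees on a smaller open set with a disc automorphism, a rotation unless `β = 2`. -/
theorem exists_moebius_of_weight_identity {β : ℝ} (hβ : 1 ≤ β) {g h : ℂ → ℂ}
    (hg : DifferentiableOn ℂ g (ball 0 1)) (hh : DifferentiableOn ℂ h (ball 0 1))
    {W₀ : Set ℂ} (hW₀ : IsOpen W₀) (hW₀ne : W₀.Nonempty)
    (hW₀sub : W₀ ⊆ ball 0 1 ∩ Complex.slitPlane) (hg0 : ∀ w ∈ W₀, g w ≠ 0)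
    (hφ : ∀ w ∈ W₀, h w / g w ∈ Complex.slitPlane)
    (hφ' : ∀ w ∈ W₀, deriv (fun w => h w / g w) w ≠ 0)
    (hv : ∀ w ∈ W₀, (1 - ‖w‖ ^ β) * ‖g w‖ = 1 - ‖h w / g w‖ ^ β) :
    ∃ s η α : ℂ, ‖s‖ < 1 ∧ ‖η‖ = 1 ∧ ‖α‖ = 1 ∧ (s ≠ 0 → β = 2) ∧
      ∃ W ⊆ W₀, IsOpen W ∧ W.Nonempty ∧ ∀ w ∈ W,
        h w / g w = η * (w - s) / (1 - conj s * w) ∧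
        g w = α * (1 - ‖s‖ ^ 2) / (1 - conj s * w) ^ 2 := by
  obtain ⟨z, hz⟩ := hW₀ne
  have hgz := hg0 z hz
  -- The rotation by `ζ` makes `ζ * g z` positive, so that the principal square root of `ζ * g` is
  -- holomorphic near `z`.
  set ζ : ℂ := conj (g z) / ‖g z‖ with hζ
  have hgzn : (‖g z‖ : ℂ) ≠ 0 := Complex.ofReal_ne_zero.mpr (norm_ne_zero_iff.mpr hgz)
  have hζ1 : ‖ζ‖ = 1 := by
    rw [hζ, norm_div, RCLike.norm_conj, Complex.norm_real, norm_norm,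
      div_self (norm_ne_zero_iff.mpr hgz)]
  have hζ0 : ζ ≠ 0 := norm_ne_zero_iff.mp (by rw [hζ1]; exact one_ne_zero)
  have hζg : ζ * g z = ‖g z‖ := by
    rw [hζ, div_mul_eq_mul_div, Complex.conj_mul', sq, mul_div_assoc, div_self hgzn, mul_one]
  have hgcont : ContinuousAt (fun w => ζ * g w) z :=
    continuousAt_const.mul
      (hg.differentiableAt (isOpen_ball.mem_nhds (hW₀sub hz).1)).continuousAt
  have hsl : (fun w => ζ * g w) ⁻¹' Complex.slitPlane ∈ 𝓝 z := by
    refine hgcont (Complex.isOpen_slitPlane.mem_nhds ?_)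
    change ζ * g z ∈ Complex.slitPlane
    rw [hζg]
    exact Complex.ofReal_mem_slitPlane.mpr (norm_pos_iff.mpr hgz)
  obtain ⟨r, hr, hrW⟩ := Metric.mem_nhds_iff.mp (Filter.inter_mem hsl (hW₀.mem_nhds hz))
  set W := ball z r with hWdef
  have hW : IsOpen W := isOpen_ball
  have hWne : W.Nonempty := ⟨z, mem_ball_self hr⟩
  have hWc : IsPreconnected W := (convex_ball z r).isPreconnected
  have hWW₀ : W ⊆ W₀ := fun w hw => (hrW hw).2
  have hWb : W ⊆ ball 0 1 := fun w hw => (hW₀sub (hWW₀ hw)).1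
  have hWs : W ⊆ Complex.slitPlane := fun w hw => (hW₀sub (hWW₀ hw)).2
  have hκ : 0 < β / 2 := by linarith
  obtain ⟨κ, hκdef⟩ : ∃ κ, κ = β / 2 := ⟨_, rfl⟩
  rw [← hκdef] at hκ
  have hnpow : ∀ u : ℂ, ‖u ^ (κ : ℂ)‖ ^ 2 = ‖u‖ ^ β := by
    intro u
    rw [Complex.norm_cpow_real, ← Real.rpow_natCast, ← Real.rpow_mul (norm_nonneg _), hκdef]
    norm_num
  have hφd : DifferentiableOn ℂ (fun w => h w / g w) W :=
    (hh.mono hWb).div (hg.mono hWb) fun w hw => hg0 w (hWW₀ hw)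
  have hAd : ∀ w ∈ W, HasDerivAt (fun w => (h w / g w) ^ (κ : ℂ))
      (κ * (h w / g w) ^ ((κ : ℂ) - 1) * deriv (fun w => h w / g w) w) w := fun w hw =>
    (hφd.differentiableAt (hW.mem_nhds hw)).hasDerivAt.cpow_const (hφ w (hWW₀ hw))
  have hAdiff : DifferentiableOn ℂ (fun w => (h w / g w) ^ (κ : ℂ)) W := fun w hw =>
    (hAd w hw).differentiableAt.differentiableWithinAt
  have hBdiff : DifferentiableOn ℂ (fun w : ℂ => w ^ (κ : ℂ)) Complex.slitPlane := fun w hw =>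
    ((hasDerivAt_id w).cpow_const (c := (κ : ℂ)) hw).differentiableAt.differentiableWithinAt
  have hGdiff : DifferentiableOn ℂ (fun w => (ζ * g w) ^ (1 / 2 : ℂ)) W := fun w hw =>
    ((((hg.mono hWb).differentiableAt (hW.mem_nhds hw)).hasDerivAt.const_mul ζ).cpow_const
      (hrW hw).1).differentiableAt.differentiableWithinAt
  have hG2 : ∀ w, ((ζ * g w) ^ (1 / 2 : ℂ)) ^ 2 = ζ * g w := fun w => by
    rw [← Complex.cpow_nat_mul]
    norm_num
  have hG2n : ∀ w, ‖(ζ * g w) ^ (1 / 2 : ℂ)‖ ^ 2 = ‖g w‖ := fun w => by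
    rw [← norm_pow, hG2, norm_mul, hζ1, one_mul]
  obtain ⟨s, η, c, hs, hη, hc, hsηc⟩ := exists_moebius_of_norm_sq_eq hW hWc hWne hAdiff
    (hBdiff.mono hWs) hGdiff (fun w hw => by rw [hnpow, hnpow, hG2n, hv w (hWW₀ hw)])
    (fun w hw => by
      rw [(hAd w hw).deriv]
      refine mul_ne_zero (mul_ne_zero (Complex.ofReal_ne_zero.mpr hκ.ne') ?_) (hφ' w (hWW₀ hw))
      exact fun h0 => Complex.slitPlane_ne_zero (hφ w (hWW₀ hw))
        ((Complex.cpow_eq_zero_iff _ _).mp h0).1)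
    (fun w hw h0 => mul_ne_zero hζ0 (hg0 w (hWW₀ hw)) (by rw [← hG2 w, h0]; simp))
    (fun w hw => by
      rw [Complex.norm_cpow_real]
      exact Real.rpow_lt_one (norm_nonneg _) (mem_ball_zero_iff.mp (hWb hw)) hκ)
  have hsn : (1 - (‖s‖ : ℂ) ^ 2) ≠ 0 := by
    have : 1 - ‖s‖ ^ 2 ≠ 0 := by nlinarith [norm_nonneg s]
    exact_mod_cast this
  have hc0 : c ≠ 0 := by
    rintro rfl
    rw [norm_zero] at hc
    nlinarith [norm_nonneg s]
  have hgc : ∀ w ∈ W, ζ * g w * (1 - conj s * w ^ (κ : ℂ)) ^ 2 = c ^ 2 := fun w hw => by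
    rw [← (hsηc w hw).2, mul_pow, hG2]
  have hα : ‖ζ⁻¹ * c ^ 2 / (1 - ‖s‖ ^ 2)‖ = 1 := by
    have h1 : (1 - (‖s‖ : ℂ) ^ 2) = ((‖c‖ ^ 2 : ℝ) : ℂ) := by rw [hc]; push_cast; rfl
    rw [h1, norm_div, norm_mul, norm_inv, hζ1, norm_pow, Complex.norm_real,
      Real.norm_of_nonneg (by positivity), inv_one, one_mul, div_self]
    exact pow_ne_zero _ (norm_ne_zero_iff.mpr hc0)
  by_cases hs0 : s = 0
  · -- Here `|φ(w)| = |w|`, so that `φ(w) / w` is a unimodular constant.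
    have hquot : ∀ w ∈ W, ‖h w / g w / w‖ = 1 := by
      intro w hw
      have h1 := congrArg norm (hsηc w hw).1
      rw [hs0, map_zero, zero_mul, sub_zero, sub_zero, mul_one, norm_mul, hη, one_mul,
        Complex.norm_cpow_real, Complex.norm_cpow_real] at h1
      have h2 := (Real.rpow_left_inj (norm_nonneg _) (norm_nonneg _) hκ.ne').mp h1
      rw [norm_div, h2, div_self (norm_ne_zero_iff.mpr (Complex.slitPlane_ne_zero (hWs hw)))]
    have hqd : DifferentiableOn ℂ (fun w => h w / g w / w) W :=
      hφd.div differentiableOn_id fun w hw => Complex.slitPlane_ne_zero (hWs hw)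
    have hq0 : EqOn (deriv fun w => h w / g w / w) 0 W := fun w hw => by
      have h1 := (conj_mul_deriv_of_norm_sq_eq (G := fun _ => 0) (P := fun _ => 0) (C := 1) hW hqd
        (differentiableOn_const 0) (differentiableOn_const 0)
        (fun w hw => by rw [hquot w hw]; norm_num) hw).2
      rw [deriv_const, norm_zero] at h1
      exact norm_eq_zero.mp (pow_eq_zero_iff two_ne_zero |>.mp (by linarith))
    obtain ⟨μ, hμ⟩ := hW.exists_is_const_of_deriv_eq_zero hWc hqd hq0
    refine ⟨s, μ, ζ⁻¹ * c ^ 2 / (1 - ‖s‖ ^ 2), hs, ?_, hα, fun h0 => absurd hs0 h0, W, hWW₀, hW,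
      hWne, fun w hw => ⟨?_, ?_⟩⟩
    · rw [← hμ z (mem_ball_self hr)]
      exact hquot z (mem_ball_self hr)
    · rw [(div_eq_iff (Complex.slitPlane_ne_zero (hWs hw))).mp (hμ w hw), hs0]
      simp
    · have h1 := hgc w hw
      rw [hs0] at h1 ⊢
      simp only [map_zero, zero_mul, sub_zero, one_pow, mul_one] at h1
      simp only [norm_zero, Complex.ofReal_zero, map_zero, zero_mul, sub_zero, one_pow, mul_one,
        zero_pow two_ne_zero, div_one]
      rw [← h1]
      field_simp
  · have hone : ∀ w ∈ ball (0 : ℂ) 1, 1 - conj s * w ≠ 0 := by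
      intro w hw h0
      have h1 : ‖conj s * w‖ = 1 := by rw [← sub_eq_zero.mp h0, norm_one]
      rw [norm_mul, RCLike.norm_conj] at h1
      nlinarith [mem_ball_zero_iff.mp hw, norm_nonneg w, norm_nonneg s]
    have hslit : ∀ w ∈ ball (0 : ℂ) 1 ∩ Complex.slitPlane,
        ζ * g w * (1 - conj s * w ^ (κ : ℂ)) ^ 2 = c ^ 2 := by
      have hd : DifferentiableOn ℂ (fun w => ζ * g w * (1 - conj s * w ^ (κ : ℂ)) ^ 2)
          (ball (0 : ℂ) 1 ∩ Complex.slitPlane) :=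
        ((hg.mono inter_subset_left).const_mul ζ).mul
          ((((hBdiff.mono inter_subset_right).const_mul (conj s)).const_sub 1).pow 2)
      have hopen := (isOpen_ball (x := (0 : ℂ)) (ε := 1)).inter Complex.isOpen_slitPlane
      exact (hd.analyticOnNhd hopen).eqOn_of_preconnected_of_eventuallyEq analyticOnNhd_const
        isPreconnected_ball_inter_slitPlane (hW₀sub hz)
        (Filter.eventually_of_mem (hW.mem_nhds (mem_ball_self hr)) hgc)
    obtain ⟨n, hn⟩ := exists_int_of_mul_sq_eq (g := fun w => ζ * g w) hκ (hg.const_mul ζ)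
      ((map_ne_zero _).mpr hs0) (by rwa [RCLike.norm_conj]) (pow_ne_zero 2 hc0) hslit
    have hn0 : 0 < n := by
      have : (0 : ℝ) < n := hn ▸ hκ
      exact_mod_cast this
    obtain ⟨k, rfl⟩ := Int.eq_ofNat_of_zero_le hn0.le
    have hκk : (κ : ℂ) = (k : ℂ) := by rw [hn]; simp
    simp only [hκk, Complex.cpow_natCast] at hgc hsηc
    rcases (show k = 1 ∨ 2 ≤ k by omega) with rfl | hk
    · refine ⟨s, η, ζ⁻¹ * c ^ 2 / (1 - ‖s‖ ^ 2), hs, hη, hα, fun _ => ?_, W, hWW₀, hW, hWne,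
        fun w hw => ⟨?_, ?_⟩⟩
      · have : κ = 1 := by rw [hn]; simp
        linarith
      · have h1 := (hsηc w hw).1
        rw [pow_one, pow_one] at h1
        rw [eq_div_iff (hone w (hWb hw)), h1]
      · have h1 := hgc w hw
        have h2 := hone w (hWb hw)
        rw [pow_one] at h1
        rw [div_mul_cancel₀ _ hsn, eq_div_iff (pow_ne_zero 2 h2), ← h1]
        field_simp
    · refine (pow_quotient_ne_moebius_pow (g := g) (C := ζ⁻¹ * c ^ 2) hk hg hh hs0 hs
        (norm_ne_zero_iff.mp (by rw [hη]; exact one_ne_zero))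
        (mul_ne_zero (inv_ne_zero hζ0) (pow_ne_zero 2 hc0)) ?_ ?_).elim
      · refine eqOn_ball_of_eqOn (hg.mul (by fun_prop)) (differentiableOn_const _) hW hWne hWb
          fun w hw => ?_
        have h1 := hgc w hw
        change g w * (1 - conj s * w ^ k) ^ 2 = _
        rw [← h1]
        field_simp
      · refine eqOn_ball_of_eqOn ((hh.pow k).mul (by fun_prop))
          (DifferentiableOn.mul (by fun_prop) (hg.pow k)) hW hWne hWb fun w hw => ?_
        have h1 := (hsηc w hw).1
        have h2 := pow_ne_zero k (hg0 w (hWW₀ hw))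
        rw [div_pow, div_mul_eq_mul_div, div_eq_iff h2] at h1
        exact h1

end Rigidity

/-! ### Isometries are weighted composition operators -/

section Isometry

open ComplexConjugate Topology Filter

/-- On some nonempty open set `T` is a weighted composition operator with symbol `φ = h / g`, where
`g = T 1` and `h = T id`, and the weights satisfy `v |g| = v ∘ φ`. -/
theorem exists_open_weighted_composition {β : ℝ} (hβ : 1 ≤ β)
    (T : Hv0 (powWeight β hβ) →ₗᵢ[ℂ] Hv0 (powWeight β hβ)) :
    ∃ g h : ℂ → ℂ, DifferentiableOn ℂ g (ball 0 1) ∧ DifferentiableOn ℂ h (ball 0 1) ∧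
      ∃ W : Set ℂ, IsOpen W ∧ W.Nonempty ∧ W ⊆ ball 0 1 ∩ Complex.slitPlane ∧
        ∀ w ∈ W, g w ≠ 0 ∧ h w / g w ∈ Complex.slitPlane ∧ deriv (fun w => h w / g w) w ≠ 0 ∧
          (1 - ‖w‖ ^ β) * ‖g w‖ = 1 - ‖h w / g w‖ ^ β ∧ ∀ f, T f w = g w * f (h w / g w) := by
  have hb1 : ∃ C, ∀ z ∈ ball (0 : ℂ) 1, ‖(1 : ℂ)‖ ≤ C := ⟨1, fun _ _ => by simp⟩
  have hbi : ∃ C, ∀ z ∈ ball (0 : ℂ) 1, ‖z‖ ≤ C := ⟨1, fun z hz => (mem_ball_zero_iff.mp hz).le⟩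
  set one : Hv0 (powWeight β hβ) := Hv0.ofBounded hβ (fun _ => 1) (differentiableOn_const 1) hb1
    with hone
  set idn : Hv0 (powWeight β hβ) := Hv0.ofBounded hβ (fun z => z) differentiableOn_id hbi with hidn
  obtain ⟨g, hgdef⟩ : ∃ g : ℂ → ℂ, g = T one := ⟨_, rfl⟩
  obtain ⟨h, hhdef⟩ : ∃ h : ℂ → ℂ, h = T idn := ⟨_, rfl⟩
  have hg : DifferentiableOn ℂ g (ball 0 1) := hgdef ▸ (T one).1.2.1
  have hh : DifferentiableOn ℂ h (ball 0 1) := hhdef ▸ (T idn).1.2.1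
  set Ω : Set ℂ := ball 0 1 ∩ {w | g w ≠ 0} with hΩdef
  have hΩ : IsOpen Ω := hg.continuousOn.isOpen_inter_preimage isOpen_ball isOpen_ne
  have hφ : DifferentiableOn ℂ (fun w => h w / g w) Ω :=
    (hh.mono inter_subset_left).div (hg.mono inter_subset_left) fun w hw => hw.2
  set F : Set ℂ := {w | w ∈ Ω ∧ (1 - ‖w‖ ^ β) * ‖g w‖ = 1 - ‖h w / g w‖ ^ β ∧
    ∀ f, T f w = g w * f (h w / g w)} with hFdef
  have hβ0 : 0 < β := by linarith
  have hFclosed : ∀ w ∈ Ω, w ∈ closure F → w ∈ F := by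
    intro w hw hwF
    obtain ⟨x, hxF, hx⟩ := mem_closure_iff_seq_limit.mp hwF
    have hnhds := isOpen_ball.mem_nhds hw.1
    have hgx : Tendsto (fun n => g (x n)) atTop (𝓝 (g w)) :=
      (hg.differentiableAt hnhds).continuousAt.tendsto.comp hx
    have hφx : Tendsto (fun n => h (x n) / g (x n)) atTop (𝓝 (h w / g w)) :=
      (hφ.differentiableAt (hΩ.mem_nhds hw)).continuousAt.tendsto.comp hx
    have hrp : ∀ {u : ℕ → ℂ} {l : ℂ}, Tendsto u atTop (𝓝 l) →
        Tendsto (fun n => 1 - ‖u n‖ ^ β) atTop (𝓝 (1 - ‖l‖ ^ β)) := fun hu =>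
      tendsto_const_nhds.sub (hu.norm.rpow_const (Or.inr hβ0.le))
    have heq : (1 - ‖w‖ ^ β) * ‖g w‖ = 1 - ‖h w / g w‖ ^ β := by
      refine tendsto_nhds_unique ((hrp hx).mul hgx.norm) ?_
      simp only [(hxF _).2.1]
      exact hrp hφx
    -- A limit of values of `φ` on `F` cannot lie on the unit circle, as `v |g| > 0` there.
    have hφ1 : h w / g w ∈ ball (0 : ℂ) 1 := by
      have h1 : 0 < (1 - ‖w‖ ^ β) * ‖g w‖ :=
        mul_pos ((powWeight β hβ).pos' w hw.1) (norm_pos_iff.mpr hw.2)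
      rw [mem_ball_zero_iff]
      refine lt_of_not_ge fun hge => ?_
      linarith [Real.one_le_rpow hge hβ0.le]
    refine ⟨hw, heq, fun f => ?_⟩
    have hTf : Tendsto (fun n => T f (x n)) atTop (𝓝 (T f w)) :=
      ((T f).1.2.1.differentiableAt hnhds).continuousAt.tendsto.comp hx
    have hfφ : Tendsto (fun n => f (h (x n) / g (x n))) atTop (𝓝 (f (h w / g w))) :=
      (f.1.2.1.differentiableAt (isOpen_ball.mem_nhds hφ1)).continuousAt.tendsto.comp hφx
    refine tendsto_nhds_unique hTf ?_
    simp only [(hxF _).2.2 f]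
    exact hgx.mul hfφ
  have hVF : ball (0 : ℂ) 1 ∩ Complex.slitPlane ⊆ (fun w => h w / g w) '' F := by
    intro z hz
    obtain ⟨w, hw, l, hl, hTf⟩ := exists_preimage_point hβ T hz.1
    have h1 : g w = l := by
      rw [hgdef, hTf, hone, Hv0.ofBounded_apply hβ _ _ hz.1, mul_one]
    have h2 : h w = l * z := by
      rw [hhdef, hTf, hidn, Hv0.ofBounded_apply hβ _ _ hz.1]
    have hl0 : l ≠ 0 := by
      rintro rfl
      rw [norm_zero, mul_zero] at hl
      exact ((powWeight β hβ).pos' z hz.1).ne hl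
    have h3 : h w / g w = z := by rw [h1, h2, mul_div_cancel_left₀ _ hl0]
    refine ⟨w, ⟨⟨hw, by rw [mem_ofPred_eq, h1]; exact hl0⟩, ?_, fun f => ?_⟩, h3⟩
    · rw [h3, h1]
      exact hl
    · rw [h3, h1, hTf]
  obtain ⟨w, r, hr, hrF, hrV⟩ := exists_ball_subset_of_subset_image hΩ hφ (fun w hw => hw.1)
    hFclosed (isOpen_ball.inter Complex.isOpen_slitPlane)
    ⟨((1 / 2 : ℝ) : ℂ), by simp; norm_num, Complex.ofReal_mem_slitPlane.mpr (by norm_num)⟩ hVF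
  refine ⟨g, h, hg, hh, ball w r ∩ Complex.slitPlane, isOpen_ball.inter Complex.isOpen_slitPlane,
    ?_, fun y hy => ⟨(hrF hy.1).1.1, hy.2⟩, fun y hy => ⟨(hrF hy.1).1.2, (hrV y hy.1).1.2,
      (hrV y hy.1).2, (hrF hy.1).2⟩⟩
  -- The ball contains points off the negative real axis.
  by_cases hw : w.im = 0
  · refine ⟨w + ((r / 2 : ℝ) : ℂ) * Complex.I, ?_, Or.inr ?_⟩
    · rw [mem_ball, dist_eq_norm, add_sub_cancel_left, norm_mul, Complex.norm_I, mul_one,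
        Complex.norm_real, Real.norm_of_nonneg (by positivity)]
      linarith
    · simp [hw, hr.ne']
  · exact ⟨w, mem_ball_self hr, Or.inr hw⟩

theorem one_sub_conj_mul_ne_zero {s w : ℂ} (hs : ‖s‖ < 1) (hw : ‖w‖ < 1) :
    1 - conj s * w ≠ 0 := by
  intro h0
  have h1 : ‖conj s * w‖ = 1 := by rw [← sub_eq_zero.mp h0, norm_one]
  rw [norm_mul, RCLike.norm_conj] at h1
  nlinarith [norm_nonneg w, norm_nonneg s]

/-- The disc automorphism `w ↦ η (w - s) / (1 - s̄ w)`, for `|η| = 1` and `|s| < 1`. -/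
noncomputable def discMoebius (s η : ℂ) (w : ℂ) : ℂ := η * (w - s) / (1 - conj s * w)

theorem one_sub_norm_discMoebius_sq {s η w : ℂ} (hs : ‖s‖ < 1) (hη : ‖η‖ = 1) (hw : ‖w‖ < 1) :
    1 - ‖discMoebius s η w‖ ^ 2 =
      (1 - ‖w‖ ^ 2) * ((1 - ‖s‖ ^ 2) / ‖1 - conj s * w‖ ^ 2) := by
  have h0 := norm_pos_iff.mpr (one_sub_conj_mul_ne_zero hs hw)
  have key : ‖1 - conj s * w‖ ^ 2 - ‖w - s‖ ^ 2 = (1 - ‖w‖ ^ 2) * (1 - ‖s‖ ^ 2) := by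
    have : ((‖1 - conj s * w‖ ^ 2 - ‖w - s‖ ^ 2 : ℝ) : ℂ)
        = (((1 - ‖w‖ ^ 2) * (1 - ‖s‖ ^ 2) : ℝ) : ℂ) := by
      push_cast
      rw [← Complex.mul_conj', ← Complex.mul_conj', ← Complex.mul_conj', ← Complex.mul_conj']
      simp only [map_sub, map_mul, map_one, Complex.conj_conj]
      ring
    exact_mod_cast this
  rw [discMoebius, norm_div, norm_mul, hη, one_mul, div_pow, ← mul_div_assoc, ← key,
    sub_div, div_self (pow_ne_zero 2 h0.ne')]

theorem differentiableOn_discMoebius {s η : ℂ} (hs : ‖s‖ < 1) :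
    DifferentiableOn ℂ (discMoebius s η) (ball 0 1) := by
  refine DifferentiableOn.div (by fun_prop) (by fun_prop) fun w hw => ?_
  exact one_sub_conj_mul_ne_zero hs (mem_ball_zero_iff.mp hw)

theorem mapsTo_discMoebius {s η : ℂ} (hs : ‖s‖ < 1) (hη : ‖η‖ = 1) :
    MapsTo (discMoebius s η) (ball 0 1) (ball 0 1) := by
  intro w hw
  rw [mem_ball_zero_iff] at hw ⊢
  have h := one_sub_norm_discMoebius_sq hs hη hw
  have h0 := norm_pos_iff.mpr (one_sub_conj_mul_ne_zero hs hw)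
  have h1 : 0 < 1 - ‖w‖ ^ 2 := by nlinarith [norm_nonneg w]
  have h2 : 0 < 1 - ‖s‖ ^ 2 := by nlinarith [norm_nonneg s]
  have h3 : 0 < 1 - ‖discMoebius s η w‖ ^ 2 := by
    rw [h]
    positivity
  nlinarith [norm_nonneg (discMoebius s η w)]

theorem discMoebius_discMoebius {s η w : ℂ} (hs : ‖s‖ < 1) (hη : ‖η‖ = 1) (hw : ‖w‖ < 1) :
    discMoebius (-(η * s)) η⁻¹ (discMoebius s η w) = w := by
  have hη0 : η ≠ 0 := norm_ne_zero_iff.mp (by rw [hη]; exact one_ne_zero)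
  have hηη : η * conj η = 1 := by rw [Complex.mul_conj', hη]; simp
  have h0 := one_sub_conj_mul_ne_zero hs hw
  have hs0 : 1 - conj s * s ≠ 0 := one_sub_conj_mul_ne_zero hs hs
  have h1 : 1 - conj (-(η * s)) * (η * (w - s) / (1 - conj s * w))
      = (1 - conj s * s) / (1 - conj s * w) := by
    rw [eq_div_iff h0]
    simp only [map_neg, map_mul]
    field_simp
    linear_combination conj s * (w - s) * hηη
  rw [discMoebius, discMoebius, h1, div_eq_iff (div_ne_zero hs0 h0), sub_neg_eq_add,
    ← mul_div_assoc, eq_div_iff h0, mul_add, add_mul, mul_assoc η⁻¹, div_mul_cancel₀ _ h0,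
    inv_mul_cancel_left₀ hη0, inv_mul_cancel_left₀ hη0]
  ring

theorem invOn_discMoebius {s η : ℂ} (hs : ‖s‖ < 1) (hη : ‖η‖ = 1) :
    InvOn (discMoebius (-(η * s)) η⁻¹) (discMoebius s η) (ball 0 1) (ball 0 1) := by
  have hη0 : η ≠ 0 := norm_ne_zero_iff.mp (by rw [hη]; exact one_ne_zero)
  refine ⟨fun w hw => discMoebius_discMoebius hs hη (mem_ball_zero_iff.mp hw), fun w hw => ?_⟩
  have h := discMoebius_discMoebius (s := -(η * s)) (η := η⁻¹) (w := w)
    (by rwa [norm_neg, norm_mul, hη, one_mul]) (by rw [norm_inv, hη, inv_one])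
    (mem_ball_zero_iff.mp hw)
  rwa [inv_inv, mul_neg, neg_neg, inv_mul_cancel_left₀ hη0] at h

theorem hasDerivAt_discMoebius {s η w : ℂ} (hs : ‖s‖ < 1) (hw : ‖w‖ < 1) :
    HasDerivAt (discMoebius s η) (η * (1 - ‖s‖ ^ 2) / (1 - conj s * w) ^ 2) w := by
  have h0 := one_sub_conj_mul_ne_zero hs hw
  have h := (((hasDerivAt_id w).sub_const s).const_mul η).div
    (((hasDerivAt_id w).const_mul (conj s)).const_sub 1) h0
  have heq : η * (1 - (‖s‖ : ℂ) ^ 2)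
      = η * 1 * (1 - conj s * w) - η * (w - s) * -(conj s * 1) := by
    rw [← Complex.mul_conj']
    ring
  rw [heq]
  exact h

/-- A weighted composition operator with invertible symbol `φ` whose multiplier `m` satisfies
`v |m| = v ∘ φ` has every element of `H_{v_o}` in its range. -/
theorem exists_weighted_composition_eq {β : ℝ} (hβ : 1 ≤ β) {φ ψ m : ℂ → ℂ}
    (hφ : DifferentiableOn ℂ φ (ball 0 1)) (hφb : MapsTo φ (ball 0 1) (ball 0 1))
    (hψ : DifferentiableOn ℂ ψ (ball 0 1)) (hψb : MapsTo ψ (ball 0 1) (ball 0 1))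
    (hinv : InvOn ψ φ (ball 0 1) (ball 0 1)) (hm : DifferentiableOn ℂ m (ball 0 1))
    (hv : ∀ w ∈ ball (0 : ℂ) 1, powWeight β hβ w * ‖m w‖ = powWeight β hβ (φ w))
    (f : Hv0 (powWeight β hβ)) :
    ∃ f' : Hv0 (powWeight β hβ), ∀ w ∈ ball (0 : ℂ) 1, m w * f' (φ w) = f w := by
  classical
  have hm0 : ∀ w ∈ ball (0 : ℂ) 1, m w ≠ 0 := fun w hw h0 => by
    have h1 := hv w hw
    rw [h0, norm_zero, mul_zero] at h1
    exact ((powWeight β hβ).pos' _ (hφb hw)).ne h1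
  set F : ℂ → ℂ := fun z => if z ∈ ball (0 : ℂ) 1 then f (ψ z) / m (ψ z) else 0 with hFdef
  have hF : ∀ z ∈ ball (0 : ℂ) 1, F z = f (ψ z) / m (ψ z) := fun z hz => if_pos hz
  have hFd : DifferentiableOn ℂ F (ball 0 1) :=
    ((f.1.2.1.comp hψ hψb).div (hm.comp hψ hψb) fun z hz => hm0 _ (hψb hz)).congr hF
  have hFv : ∀ z ∈ ball (0 : ℂ) 1,
      powWeight β hβ z * ‖F z‖ = powWeight β hβ (ψ z) * ‖f (ψ z)‖ := by
    intro z hz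
    have h1 := hv _ (hψb hz)
    rw [hinv.2 hz] at h1
    rw [hF z hz, ← h1, norm_div]
    have := norm_ne_zero_iff.mpr (hm0 _ (hψb hz))
    field_simp
  let F₁ : Hv (powWeight β hβ) := ⟨F, hFd, fun z hz => if_neg hz, ‖f‖, fun z hz => by
    rw [hFv z hz]
    exact f.1.le_norm (hψb hz)⟩
  refine ⟨⟨F₁, fun ε hε => ?_⟩, fun w hw => ?_⟩
  · obtain ⟨K, hKb, hK, hKf⟩ := f.2 ε hε
    refine ⟨φ '' K, (hφb.mono_left hKb).image_subset, hK.image_of_continuousOn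
      (hφ.continuousOn.mono hKb), fun z hz => ?_⟩
    change powWeight β hβ z * ‖F z‖ < ε
    rw [hFv z hz.1]
    exact hKf _ ⟨hψb hz.1, fun h => hz.2 ⟨ψ z, h, hinv.2 hz.1⟩⟩
  · change m w * F (φ w) = f w
    rw [hF _ (hφb hw), hinv.1 hw, mul_div_cancel₀ _ (hm0 w hw)]

/-- Every isometry is a weighted composition operator whose symbol is a disc automorphism, fixing
`0` unless `β = 2`. -/
theorem exists_eq_discMoebius_composition {β : ℝ} (hβ : 1 ≤ β)
    (T : Hv0 (powWeight β hβ) →ₗᵢ[ℂ] Hv0 (powWeight β hβ)) :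
    ∃ s η α : ℂ, ‖s‖ < 1 ∧ ‖η‖ = 1 ∧ ‖α‖ = 1 ∧ (s ≠ 0 → β = 2) ∧
      ∀ f, ∀ w ∈ ball (0 : ℂ) 1,
        T f w = α * (1 - ‖s‖ ^ 2) / (1 - conj s * w) ^ 2 * f (discMoebius s η w) := by
  obtain ⟨g, h, hg, hh, W₀, hW₀, hW₀ne, hW₀sub, hW₀w⟩ := exists_open_weighted_composition hβ T
  obtain ⟨s, η, α, hs, hη, hα, hsβ, W, hWW₀, hW, hWne, hWw⟩ :=
    exists_moebius_of_weight_identity hβ hg hh hW₀ hW₀ne hW₀sub (fun w hw => (hW₀w w hw).1)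
      (fun w hw => (hW₀w w hw).2.1) (fun w hw => (hW₀w w hw).2.2.1)
      (fun w hw => (hW₀w w hw).2.2.2.1)
  refine ⟨s, η, α, hs, hη, hα, hsβ, fun f => ?_⟩
  refine eqOn_ball_of_eqOn (T f).1.2.1 (DifferentiableOn.mul ?_
    (f.1.2.1.comp (differentiableOn_discMoebius hs) (mapsTo_discMoebius hs hη))) hW hWne
    (fun w hw => (hW₀sub (hWW₀ hw)).1) fun w hw => ?_
  · refine DifferentiableOn.div (by fun_prop) (by fun_prop) fun w hw => ?_
    exact pow_ne_zero 2 (one_sub_conj_mul_ne_zero hs (mem_ball_zero_iff.mp hw))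
  · rw [(hW₀w w (hWW₀ hw)).2.2.2.2 f, (hWw w hw).1]
    nth_rewrite 1 [(hWw w hw).2]
    rfl

end Isometry

theorem theorem5p2 (β : ℝ) (hβ : 1 ≤ β)
    (T : Hv0 (powWeight β hβ) →ₗᵢ[ℂ] Hv0 (powWeight β hβ)) :
    (β = 2 → ∃ (φ : ℂ → ℂ) (α : ℂ), IsDiscAutomorphism φ ∧ ‖α‖ = 1 ∧
      ∀ (f : Hv0 (powWeight β hβ)), ∀ z ∈ ball (0 : ℂ) 1,
        T f z = α * deriv φ z * f (φ z)) ∧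
    (β ≠ 2 → ∃ (θ : ℝ) (α : ℂ), ‖α‖ = 1 ∧
      ∀ (f : Hv0 (powWeight β hβ)), ∀ z ∈ ball (0 : ℂ) 1,
        T f z = α * f (z * Complex.exp (θ * Complex.I))) ∧
    Function.Surjective T := by
  obtain ⟨s, η, α, hs, hη, hα, hsβ, hT⟩ := exists_eq_discMoebius_composition hβ T
  have hη0 : η ≠ 0 := norm_ne_zero_iff.mp (by rw [hη]; exact one_ne_zero)
  have hs' : ‖-(η * s)‖ < 1 := by rwa [norm_neg, norm_mul, hη, one_mul]
  have hη' : ‖η⁻¹‖ = 1 := by rw [norm_inv, hη, inv_one]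
  have hinv := invOn_discMoebius hs hη
  refine ⟨fun _ => ⟨discMoebius s η, α / η, ⟨differentiableOn_discMoebius hs,
    mapsTo_discMoebius hs hη, discMoebius (-(η * s)) η⁻¹, differentiableOn_discMoebius hs',
    mapsTo_discMoebius hs' hη', hinv⟩, by rw [norm_div, hα, hη, div_one], fun f z hz => ?_⟩,
    fun hβ2 => ?_, fun f => ?_⟩
  · rw [hT f z hz, (hasDerivAt_discMoebius hs (mem_ball_zero_iff.mp hz)).deriv]
    field_simp
  · have hs0 : s = 0 := by_contra fun h => hβ2 (hsβ h)
    refine ⟨η.arg, α, hα, fun f z hz => ?_⟩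
    have h1 : Complex.exp (η.arg * Complex.I) = η := by
      have := Complex.norm_mul_exp_arg_mul_I η
      rwa [hη, Complex.ofReal_one, one_mul] at this
    rw [hT f z hz, hs0, h1, discMoebius]
    simp [mul_comm]
  · obtain ⟨f', hf'⟩ := exists_weighted_composition_eq hβ (differentiableOn_discMoebius hs)
      (mapsTo_discMoebius hs hη) (differentiableOn_discMoebius hs') (mapsTo_discMoebius hs' hη')
      hinv (m := fun w => α * (1 - ‖s‖ ^ 2) / (1 - (starRingEnd ℂ) s * w) ^ 2) (by
        refine DifferentiableOn.div (by fun_prop) (by fun_prop) fun w hw => ?_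
        exact pow_ne_zero 2 (one_sub_conj_mul_ne_zero hs (mem_ball_zero_iff.mp hw)))
      (fun w hw => by
        have hw1 := mem_ball_zero_iff.mp hw
        have hsn : 0 ≤ 1 - ‖s‖ ^ 2 := by nlinarith [norm_nonneg s]
        have hn : ‖α * (1 - (‖s‖ : ℂ) ^ 2) / (1 - (starRingEnd ℂ) s * w) ^ 2‖
            = (1 - ‖s‖ ^ 2) / ‖1 - (starRingEnd ℂ) s * w‖ ^ 2 := by
          have : (1 - (‖s‖ : ℂ) ^ 2) = ((1 - ‖s‖ ^ 2 : ℝ) : ℂ) := by push_cast; rfl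
          rw [norm_div, norm_mul, hα, one_mul, norm_pow, this, Complex.norm_real,
            Real.norm_of_nonneg hsn]
        rw [hn, powWeight_apply, powWeight_apply]
        by_cases hs0 : s = 0
        · rw [discMoebius, hs0]
          simp [hη]
        · have hβ2 := hsβ hs0
          rw [hβ2, Real.rpow_two, Real.rpow_two, one_sub_norm_discMoebius_sq hs hη hw1]) f
    refine ⟨f', Subtype.ext (Subtype.ext (funext fun w => ?_))⟩
    by_cases hw : w ∈ ball (0 : ℂ) 1
    · exact (hT f' w hw).trans (hf' w hw)
    · exact ((T f').1.2.2.1 w hw).trans (f.1.2.2.1 w hw).symm
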